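/- Let $K\subseteq\mathbb R^n$ be open and let $\mathcal O_K$ be the algebra of operators on $C^\infty(K)$ (real functions) generated by $\hat p_i=\partial/\partial x_i$ and by multiplications by functions in $C^\infty(K)$. Every $\mathcal F\in\mathcal O_K$ is uniquely $\sum_{|\alpha|\le m}A_\alpha(x)\hat p^\alpha$; its symbol is $F(x,p)=\sum A_\alpha(x)p^\alpha$ on $K\times\mathbb R^n_p$. The order $\operatorname{ord}\mathcal F$ is the largest $m$ for which the part of $F$ homogeneous of degree $m$ in $p$ is nonzero ($\operatorname{ord} 0=0$), the main symbol $MF$ is the part of degree $m=\operatorname{ord}\mathcal F$, and the second-main symbol $M'F$ is the part of degree $m-1$ if $m>0$, and $0$ if $m=0$. For functions $A,B$ on phase space let $\{A,B\}^+=\sum_{i=1}^n\frac{\partial A}{\partial p_i}\frac{\partial B}{\partial x_i}$. A noncommutative polynomial $S(G,F)$ in commuting variables $G=(G_1,\dots,G_l)$ and noncommutative symbols $F=(F_1,\dots,F_m)$ is a finite formal sum of monomials $Z_0F_{\beta_1}Z_1\cdots F_{\beta_q}Z_q$ with $Z_k\in C^\infty(\mathbb R^l)$ functions of $G$, multilinear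 over $\mathbb R$ in $(Z_0,\dots,Z_q)$ and with no other relations. Its abelianization $S_C$ is obtained by letting all variables commute. Given a finite family $\mathcal V$ of operators in $\mathcal O_K$, let the variables $G$ correspond to its members of order $0$ and the symbols $F$ to its members of positive order. Then $S(\mathcal V)$ denotes the operator obtained by substitution, and the main part $\mathcal M_{\mathcal V}S$ is the nonzero part of $S$ of largest weight, where $F_{\beta_1},\dots,F_{\beta_q}$ contribute the weight $\sum_j\operatorname{ord}\mathcal F_{\beta_j}$. Let $(\bar x,\bar p)\in K\times\mathbb R^n_p$, $\mathcal W=(\mathcal W_1,\dots,\mathcal W_s)$ and $\mathcal Y=(\mathcal Y_1,\dots,\mathcal Y_r)$ in $\mathcal O_K$. $\mathcal W$ is algebraically dependent on $\mathcal Y$ at $(\bar x,\bar p)$ if there are noncommutative polynomials $S_1,\dots,S_s$ in the variables $(W,Y)$ such that $\det\frac{\partial(\mathcal M_{(\mathcal W,\mathcal Y)}S)_C}{\partial W}\ne0$ at the point $(MW,MY)(\bar x,\bar p)$ and such that all $S_i(\mathcal W,\mathcal Y)$ vanish as operators in a neighbourhood of $\bar x$. Write $\mathcal W\sqsubseteq\mathcal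 Y$ at $(\bar x,\bar p)$ if there is a finite chain of finite sets of operators in $\mathcal O_K$ from $\mathcal W$ to $\mathcal Y$, each algebraically dependent on the next at $(\bar x,\bar p)$. The rank $\operatorname{rank}\mathcal W(x,p)$ is the least $r\geq 0$ for which $\mathcal W\sqsubseteq(\mathcal Y_1,\dots,\mathcal Y_r)$ at $(x,p)$ for some $\mathcal Y_1,\dots,\mathcal Y_r\in\mathcal O_K$; $\mathcal W$ is regularly dependent at $(x,p)$ if this holds for some $r<s$. The main dimension $r_{\mathcal W}(x,p)$ is the dimension of the span of $d(MW_1),\dots,d(MW_s)$ at $(x,p)$. **Proposition.** Let $\mathcal W=(\mathcal W_1,\dots,\mathcal W_s)$ be a set of operators in $\mathcal O_K$ and $(\bar x,\bar p)\in K\times\mathbb R^n_p$ a point with $r_{\mathcal W}(\bar x,\bar p)=s-1$. If $\mathcal W$ is regularly dependent at $(\bar x,\bar p)$, then there is a neighbourhood $O\subset K\times\mathbb R^n_p$ of $(\bar x,\bar p)$ such that for all $(x,p)\in O$: 1. $\operatorname{rank}\mathcal W(x,p)=r_{\mathcal W}(x,p)=s-1$; 2. for every $\gamma\in\mathbb R^s\setminus\{0\}$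 with $\sum_{i=1}^s\gamma_i\,d(MW_i)(x,p)=0$, the covector $v=\sum_{i=1}^s\gamma_i\,d(M'W_i)(x,p)$ belongs to the linear span of the covectors $d(MW_i)(x,p)$ and $d\{MW_i,MW_j\}^+(x,p)$, $i,j=1,\dots,s$. -/

import Mathlib

open Filter Topology TopologicalSpace
open scoped ContDiff DirectSum TensorProduct

noncomputable section

namespace DiffOps

/-! ### Smooth functions on an open set -/

/-- The extension by zero of a function on the open set `K` to all of `ℝⁿ`; only its values on `K`
matter. -/
def ext {n : ℕ} {K : Opens (Fin n → ℝ)} (f : K → ℝ) : (Fin n → ℝ) → ℝ :=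
  Function.extend Subtype.val f 0

theorem ext_apply {n : ℕ} {K : Opens (Fin n → ℝ)} (f : K → ℝ) (x : K) : ext f x = f x :=
  Subtype.val_injective.extend_apply f 0 x

theorem contDiffOn_ext {n : ℕ} {K : Opens (Fin n → ℝ)} {f : K → ℝ} {g : (Fin n → ℝ) → ℝ}
    (hg : ContDiffOn ℝ ∞ g K) (h : ∀ x : K, f x = g x) : ContDiffOn ℝ ∞ (ext f) K :=
  hg.congr fun x hx => (ext_apply f ⟨x, hx⟩).trans (h ⟨x, hx⟩)

/-- The algebra `C^∞(K)` of real smooth functions on the open set `K ⊆ ℝⁿ`. -/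
def smoothSubalgebra {n : ℕ} (K : Opens (Fin n → ℝ)) : Subalgebra ℝ (K → ℝ) where
  carrier := {f | ContDiffOn ℝ ∞ (ext f) K}
  mul_mem' := fun {f g} hf hg =>
    contDiffOn_ext (hf.mul hg) fun x => by simp [ext_apply]
  add_mem' := fun {f g} hf hg =>
    contDiffOn_ext (hf.add hg) fun x => by simp [ext_apply]
  algebraMap_mem' := fun c =>
    contDiffOn_ext (contDiffOn_const (c := c)) fun x => rfl

/-- The algebra `C^∞(K)`, as a type. -/
abbrev Smooth {n : ℕ} (K : Opens (Fin n → ℝ)) : Type := smoothSubalgebra K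

theorem contDiffAt_ext {n : ℕ} {K : Opens (Fin n → ℝ)} (f : Smooth K) (x : K) :
    ContDiffAt ℝ ∞ (ext f.1) x :=
  (f.2 : ContDiffOn ℝ ∞ (ext f.1) K).contDiffAt (K.isOpen.mem_nhds x.2)

theorem differentiableAt_ext {n : ℕ} {K : Opens (Fin n → ℝ)} (f : Smooth K) (x : K) :
    DifferentiableAt ℝ (ext f.1) x :=
  (contDiffAt_ext f x).differentiableAt (by simp)

theorem fderiv_ext_congr {n : ℕ} {K : Opens (Fin n → ℝ)} {f : K → ℝ} {g : (Fin n → ℝ) → ℝ}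
    (h : ∀ x : K, f x = g x) (x : K) : fderiv ℝ (ext f) x = fderiv ℝ g x := by
  apply Filter.EventuallyEq.fderiv_eq
  filter_upwards [K.isOpen.mem_nhds x.2] with y hy
  exact (ext_apply f ⟨y, hy⟩).trans (h ⟨y, hy⟩)

/-- The operator `p̂ᵢ = ∂/∂xᵢ` on `C^∞(K)`. -/
def pderiv {n : ℕ} {K : Opens (Fin n → ℝ)} (i : Fin n) : Module.End ℝ (Smooth K) where
  toFun f := ⟨fun x => fderiv ℝ (ext f.1) x (Pi.single i 1), by
    have h : ContDiffOn ℝ ∞ (fderiv ℝ (ext f.1)) K :=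
      (f.2 : ContDiffOn ℝ ∞ (ext f.1) K).fderiv_of_isOpen K.isOpen (by simp)
    exact contDiffOn_ext (h.clm_apply contDiffOn_const) fun x => rfl⟩
  map_add' f g := by
    ext x
    have h : fderiv ℝ (ext (f.1 + g.1)) x = fderiv ℝ (ext f.1 + ext g.1) x :=
      fderiv_ext_congr (fun y => by simp [ext_apply]) x
    have h2 := fderiv_add (differentiableAt_ext f x) (differentiableAt_ext g x)
    simp [h, h2]
  map_smul' c f := by
    ext x
    have h : fderiv ℝ (ext (c • f.1)) x = fderiv ℝ (c • ext f.1) x :=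
      fderiv_ext_congr (fun y => by simp [ext_apply]) x
    have h2 := fderiv_const_smul (differentiableAt_ext f x) c
    simp [h, h2]

theorem pderiv_mul {n : ℕ} {K : Opens (Fin n → ℝ)} (i : Fin n) (f g : Smooth K) :
    pderiv i (f * g) = f * pderiv i g + pderiv i f * g := by
  ext x
  have h : fderiv ℝ (ext (f.1 * g.1)) x = fderiv ℝ (ext f.1 * ext g.1) x :=
    fderiv_ext_congr (fun y => by simp [ext_apply]) x
  have h2 := fderiv_mul (differentiableAt_ext f x) (differentiableAt_ext g x)
  simp [pderiv, h, h2, ext_apply, mul_comm]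

theorem pderiv_comm {n : ℕ} {K : Opens (Fin n → ℝ)} (i j : Fin n) :
    Commute (pderiv i : Module.End ℝ (Smooth K)) (pderiv j) := by
  refine LinearMap.ext fun f => ?_
  ext x
  have key : ∀ a b : Fin n, (pderiv a (pderiv b f)).1 x =
      fderiv ℝ (fderiv ℝ (ext f.1)) x (Pi.single a 1) (Pi.single b 1) := by
    intro a b
    have h : fderiv ℝ (ext (pderiv b f).1) x =
        fderiv ℝ (fun y => fderiv ℝ (ext f.1) y (Pi.single b 1)) x :=
      fderiv_ext_congr (f := (pderiv b f).1) (fun y => rfl) x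
    have hd : DifferentiableAt ℝ (fderiv ℝ (ext f.1)) x :=
      ((contDiffAt_ext f x).fderiv_right (m := 1) (WithTop.coe_le_coe.2 (le_top : (1 + 1 : ℕ∞) ≤ ⊤))).differentiableAt
        (by simp)
    show fderiv ℝ (ext (pderiv b f).1) x (Pi.single a 1) = _
    rw [h, fderiv_clm_apply hd (differentiableAt_const _)]
    simp
  have hs : IsSymmSndFDerivAt ℝ (ext f.1) (x : Fin n → ℝ) :=
    (contDiffAt_ext f x).isSymmSndFDerivAt
      (by simpa using (WithTop.coe_le_coe.2 (le_top : (2 : ℕ∞) ≤ ⊤)))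
  show (pderiv i (pderiv j f)).1 x = (pderiv j (pderiv i f)).1 x
  rw [key, key]
  exact hs _ _

/-! ### Differential operators of class `𝒪` and their symbols -/

/-- The algebra `𝒪_K` of operators on `C^∞(K)` generated by the `p̂ᵢ` and by the operators of
multiplication by smooth functions. -/
def classO {n : ℕ} (K : Opens (Fin n → ℝ)) : Subalgebra ℝ (Module.End ℝ (Smooth K)) :=
  Algebra.adjoin ℝ (Set.range pderiv ∪ Set.range (Algebra.lmul ℝ (Smooth K)))

/-- An operator of class `𝒪_K`. -/
abbrev DiffOp {n : ℕ} (K : Opens (Fin n → ℝ)) : Type := classO K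

/-- The operator `p̂^α = ∂^|α| / ∂x₁^α₁ ⋯ ∂xₙ^αₙ`. -/
def pderivPow {n : ℕ} {K : Opens (Fin n → ℝ)} (α : Fin n →₀ ℕ) : Module.End ℝ (Smooth K) :=
  ((List.finRange n).map fun i => pderiv i ^ α i).prod

/-- The standard quantization `∑ A_α(x) p̂^α` of the polynomial `∑ A_α(x) p^α` in `p` with
coefficients in `C^∞(K)`. -/
def quantize {n : ℕ} {K : Opens (Fin n → ℝ)} (P : MvPolynomial (Fin n) (Smooth K)) :
    Module.End ℝ (Smooth K) :=
  ∑ α ∈ P.support, Algebra.lmul ℝ (Smooth K) (P.coeff α) * pderivPow α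

theorem quantize_eq_sum {n : ℕ} {K : Opens (Fin n → ℝ)} (P : MvPolynomial (Fin n) (Smooth K))
    (t : Finset (Fin n →₀ ℕ)) (ht : P.support ⊆ t) :
    quantize P = ∑ α ∈ t, Algebra.lmul ℝ (Smooth K) (P.coeff α) * pderivPow α := by
  refine Finset.sum_subset ht fun α _ h => ?_
  rw [MvPolynomial.notMem_support_iff.1 h, map_zero, zero_mul]

theorem quantize_add {n : ℕ} {K : Opens (Fin n → ℝ)} (P Q : MvPolynomial (Fin n) (Smooth K)) :
    quantize (P + Q) = quantize P + quantize Q := by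
  classical
  rw [quantize_eq_sum (P + Q) (P.support ∪ Q.support) MvPolynomial.support_add,
    quantize_eq_sum P (P.support ∪ Q.support) Finset.subset_union_left,
    quantize_eq_sum Q (P.support ∪ Q.support) Finset.subset_union_right,
    ← Finset.sum_add_distrib]
  simp [add_mul]

theorem quantize_monomial {n : ℕ} {K : Opens (Fin n → ℝ)} (α : Fin n →₀ ℕ) (a : Smooth K) :
    quantize (MvPolynomial.monomial α a) = Algebra.lmul ℝ (Smooth K) a * pderivPow α := by
  classical
  rw [quantize_eq_sum _ {α} MvPolynomial.support_monomial_subset]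
  simp

theorem quantize_zero {n : ℕ} {K : Opens (Fin n → ℝ)} :
    quantize (0 : MvPolynomial (Fin n) (Smooth K)) = 0 := by
  simp [quantize]

theorem list_prod_pow_aux {ι A : Type*} [DecidableEq ι] [Monoid A] (f : ι → A)
    (hf : ∀ i j, Commute (f i) (f j)) (a b : ι → ℕ) (i : ι) (hi : b i = a i + 1)
    (hb : ∀ j, j ≠ i → b j = a j) (l : List ι) (hl : l.Nodup) (hil : i ∈ l) :
    f i * (l.map fun j => f j ^ a j).prod = (l.map fun j => f j ^ b j).prod := by
  induction l with
  | nil => simp at hil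
  | cons j l ih =>
    rw [List.nodup_cons] at hl
    simp only [List.map_cons, List.prod_cons]
    by_cases h : j = i
    · subst h
      have : (l.map fun k => f k ^ a k) = l.map fun k => f k ^ b k := by
        refine List.map_congr_left fun k hk => ?_
        rw [hb k (fun hkj => hl.1 (hkj ▸ hk))]
      rw [this, hi, pow_succ', mul_assoc]
    · have hil : i ∈ l := by
        rcases List.mem_cons.1 hil with h1 | h1
        · exact absurd h1.symm h
        · exact h1
      rw [← mul_assoc, ((hf i j).pow_right _).eq, mul_assoc, ih hl.2 hil, hb j h]

theorem pderiv_mul_pderivPow {n : ℕ} {K : Opens (Fin n → ℝ)} (i : Fin n) (α : Fin n →₀ ℕ) :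
    (pderiv i * pderivPow α : Module.End ℝ (Smooth K)) = pderivPow (α + Finsupp.single i 1) := by
  refine list_prod_pow_aux pderiv pderiv_comm α (α + Finsupp.single i 1 : Fin n →₀ ℕ) i ?_ ?_ _
    (List.nodup_finRange n) (List.mem_finRange i)
  · simp
  · intro j hj
    simp [hj.symm]

/-- Every operator of class `𝒪_K` has a standard representation. -/
theorem exists_quantize_eq {n : ℕ} {K : Opens (Fin n → ℝ)} (F : DiffOp K) :
    ∃ P : MvPolynomial (Fin n) (Smooth K), quantize P = F.1 := by
  obtain ⟨F, hF⟩ := F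
  show ∃ P, quantize P = F
  unfold classO at hF
  rw [← Subalgebra.mem_toSubmodule, Algebra.adjoin_eq_span] at hF
  induction hF using Submodule.span_induction with
  | zero => exact ⟨0, quantize_zero⟩
  | add x y _ _ hx hy =>
    obtain ⟨P, rfl⟩ := hx
    obtain ⟨Q, rfl⟩ := hy
    exact ⟨P + Q, quantize_add P Q⟩
  | smul c x hx1 hx =>
    clear hx1
    obtain ⟨P, rfl⟩ := hx
    induction P using MvPolynomial.induction_on' with
    | monomial α a =>
      refine ⟨MvPolynomial.monomial α (c • a), ?_⟩
      rw [quantize_monomial, quantize_monomial, map_smul, smul_mul_assoc]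
    | add P Q hP hQ =>
      obtain ⟨P', hP'⟩ := hP
      obtain ⟨Q', hQ'⟩ := hQ
      exact ⟨P' + Q', by rw [quantize_add, quantize_add, smul_add, hP', hQ']⟩
  | mem x hx =>
    induction hx using Submonoid.closure_induction_left with
    | one =>
      refine ⟨MvPolynomial.monomial 0 1, ?_⟩
      rw [quantize_monomial, map_one, one_mul]
      simp [pderivPow]
    | mul_left x hx y hy1 hy =>
      clear hy1
      obtain ⟨P, rfl⟩ := hy
      induction P using MvPolynomial.induction_on' with
      | monomial α a =>
        rw [quantize_monomial]
        rcases hx with ⟨i, rfl⟩ | ⟨f, rfl⟩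
        · refine ⟨MvPolynomial.monomial (α + Finsupp.single i 1) a +
            MvPolynomial.monomial α (pderiv i a), ?_⟩
          rw [quantize_add, quantize_monomial, quantize_monomial, ← pderiv_mul_pderivPow,
            ← mul_assoc, ← mul_assoc, ← add_mul]
          congr 1
          refine LinearMap.ext fun g => ?_
          exact (pderiv_mul i a g).symm
        · refine ⟨MvPolynomial.monomial α (f * a), ?_⟩
          rw [quantize_monomial, map_mul, mul_assoc]
      | add P Q hP hQ =>
        obtain ⟨P', hP'⟩ := hP
        obtain ⟨Q', hQ'⟩ := hQ
        exact ⟨P' + Q', by rw [quantize_add, quantize_add, mul_add, hP', hQ']⟩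

/-- The exponential function `x ↦ exp (λ₁ x₁ + ⋯ + λₙ xₙ)`. -/
def expFun {n : ℕ} (K : Opens (Fin n → ℝ)) (l : Fin n → ℝ) : Smooth K :=
  ⟨fun x => Real.exp (∑ i, l i * x.1 i), contDiffOn_ext
    (g := fun x : Fin n → ℝ => Real.exp (∑ i, l i * x i))
    (ContDiff.contDiffOn (by fun_prop)) fun x => rfl⟩

theorem pderiv_expFun {n : ℕ} {K : Opens (Fin n → ℝ)} (l : Fin n → ℝ) (i : Fin n) :
    pderiv i (expFun K l) = l i • expFun K l := by
  ext x
  have h : fderiv ℝ (ext (expFun K l).1) x =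
      fderiv ℝ (fun x : Fin n → ℝ => Real.exp (∑ i, l i * x i)) x :=
    fderiv_ext_congr (f := (expFun K l).1) (fun y => rfl) x
  have h2 : HasFDerivAt (fun x : Fin n → ℝ => ∑ i, l i * x i)
      (∑ i, l i • ContinuousLinearMap.proj (R := ℝ) (φ := fun _ : Fin n => ℝ) i) x.1 :=
    HasFDerivAt.fun_sum fun i _ => ((ContinuousLinearMap.proj (R := ℝ)
      (φ := fun _ : Fin n => ℝ) i).hasFDerivAt).const_mul (l i)
  show fderiv ℝ (ext (expFun K l).1) x (Pi.single i 1) = _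
  rw [h, h2.exp.fderiv]
  simp [expFun, Pi.single_apply, mul_comm]

/-- The standard representation is unique. -/
theorem quantize_injective {n : ℕ} {K : Opens (Fin n → ℝ)} :
    Function.Injective (quantize (K := K)) := by
  intro P Q hPQ
  have hpow : ∀ (l : Fin n → ℝ) (α : Fin n →₀ ℕ),
      pderivPow α (expFun K l) = (∏ i, l i ^ α i) • expFun K l := by
    intro l α
    have h1 : ∀ (i : Fin n) (k : ℕ), (pderiv i ^ k) (expFun K l) = l i ^ k • expFun K l := by
      intro i k
      induction k with
      | zero => simp
      | succ k ih => rw [pow_succ', Module.End.mul_apply, ih, map_smul, pderiv_expFun, smul_smul,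
          pow_succ]
    have h2 : ∀ L : List (Fin n), (L.map fun i => pderiv i ^ α i).prod (expFun K l) =
        (L.map fun i => l i ^ α i).prod • expFun K l := by
      intro L
      induction L with
      | nil => simp
      | cons i L ih => rw [List.map_cons, List.map_cons, List.prod_cons, List.prod_cons,
          Module.End.mul_apply, ih, map_smul, h1, smul_smul, mul_comm]
    rw [pderivPow, h2, ← List.ofFn_eq_map, List.prod_ofFn]
  have hev : ∀ (R : MvPolynomial (Fin n) (Smooth K)) (x : K) (l : Fin n → ℝ),
      (quantize R (expFun K l)).1 x = MvPolynomial.eval l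
        (MvPolynomial.map ((Pi.evalRingHom (fun _ : K => ℝ) x).comp
          (smoothSubalgebra K).val.toRingHom) R) * (expFun K l).1 x := by
    intro R x l
    induction R using MvPolynomial.induction_on' with
    | monomial α a =>
      rw [quantize_monomial, Module.End.mul_apply, hpow]
      simp [MvPolynomial.eval_monomial, Finsupp.prod_fintype]
      ring
    | add R R' h h' =>
      rw [quantize_add]
      simp only [map_add, add_mul, ← h, ← h']
      rfl
  ext α x
  have hx : MvPolynomial.map ((Pi.evalRingHom (fun _ : K => ℝ) x).comp
          (smoothSubalgebra K).val.toRingHom) P = MvPolynomial.map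
          ((Pi.evalRingHom (fun _ : K => ℝ) x).comp (smoothSubalgebra K).val.toRingHom) Q := by
    refine MvPolynomial.funext fun l => ?_
    have h := hev P x l
    rw [hPQ, hev Q x l] at h
    exact (mul_right_cancel₀ (Real.exp_pos _).ne' h).symm
  have := congrArg (MvPolynomial.coeff α) hx
  rw [MvPolynomial.coeff_map, MvPolynomial.coeff_map] at this
  exact this

/-- The symbol of an operator of class `𝒪_K`, as a polynomial in `p` with coefficients in
`C^∞(K)`: the coefficients are those of the standard representation of the operator. -/
def symbol {n : ℕ} {K : Opens (Fin n → ℝ)} (F : DiffOp K) : MvPolynomial (Fin n) (Smooth K) :=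
  (exists_quantize_eq F).choose

theorem quantize_symbol {n : ℕ} {K : Opens (Fin n → ℝ)} (F : DiffOp K) :
    quantize (symbol F) = F.1 :=
  (exists_quantize_eq F).choose_spec

/-- The order of an operator (the zero operator, being a multiplication operator, has order `0`). -/
def ord {n : ℕ} {K : Opens (Fin n → ℝ)} (F : DiffOp K) : ℕ := (symbol F).totalDegree

/-- The function `(x, p) ↦ ∑ A_α(x) p^α` given by a polynomial in `p` with coefficients in
`C^∞(K)`; only its values for `x ∈ K` matter. -/
def polyFun {n : ℕ} {K : Opens (Fin n → ℝ)} (P : MvPolynomial (Fin n) (Smooth K)) :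
    (Fin n → ℝ) × (Fin n → ℝ) → ℝ :=
  fun z => ∑ α ∈ P.support, ext (P.coeff α).1 z.1 * ∏ i, z.2 i ^ α i

/-- The symbol `MF` of the main part of `F`, as a function of `(x, p)`. -/
def mainSymbol {n : ℕ} {K : Opens (Fin n → ℝ)} (F : DiffOp K) :
    (Fin n → ℝ) × (Fin n → ℝ) → ℝ :=
  polyFun (MvPolynomial.homogeneousComponent (ord F) (symbol F))

/-- The symbol `M'F` of the second-main part of `F`, as a function of `(x, p)`. -/
def secondMainSymbol {n : ℕ} {K : Opens (Fin n → ℝ)} (F : DiffOp K) :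
    (Fin n → ℝ) × (Fin n → ℝ) → ℝ :=
  if 0 < ord F then polyFun (MvPolynomial.homogeneousComponent (ord F - 1) (symbol F)) else 0

/-- The Poisson semi-bracket `{A, B}⁺ = ∑ᵢ ∂A/∂pᵢ ∂B/∂xᵢ`. -/
def semiBracket {n : ℕ} (A B : (Fin n → ℝ) × (Fin n → ℝ) → ℝ) :
    (Fin n → ℝ) × (Fin n → ℝ) → ℝ :=
  fun z => ∑ i, fderiv ℝ A z (0, Pi.single i 1) * fderiv ℝ B z (Pi.single i 1, 0)

/-! ### Noncommutative polynomials -/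

/-- The algebra of smooth functions of the commuting variables `G = (G_j)`, `j ∈ γ`. -/
def coeffSubalgebra (γ : Type) [Fintype γ] : Subalgebra ℝ ((γ → ℝ) → ℝ) where
  carrier := {Z | ContDiff ℝ ∞ Z}
  mul_mem' := fun {f g} (hf : ContDiff ℝ ∞ f) (hg : ContDiff ℝ ∞ g) => hf.mul hg
  add_mem' := fun {f g} (hf : ContDiff ℝ ∞ f) (hg : ContDiff ℝ ∞ g) => hf.add hg
  algebraMap_mem' := fun c => (contDiff_const : ContDiff ℝ ∞ fun _ : γ → ℝ => c)

/-- The algebra of smooth functions of the commuting variables, as a type. -/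
abbrev Coeff (γ : Type) [Fintype γ] : Type := coeffSubalgebra γ

/-- The finite sequences `β = (β₁, …, β_q)` of indices in `φ`. -/
abbrev Word (φ : Type) : Type := Σ q : ℕ, (Fin q → φ)

/-- The noncommutative polynomials in the commuting variables `G_j`, `j ∈ γ`, and the
noncommutative symbols `F_i`, `i ∈ φ`. The component at `β = (β₁, …, β_q)` is the sum of the
monomials `Z₀ F_{β₁} Z₁ F_{β₂} ⋯ F_{β_q} Z_q`; this monomial is represented by the pure tensor
`Z₀ ⊗ Z₁ ⊗ ⋯ ⊗ Z_q`. -/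
abbrev NCPoly (γ φ : Type) [Fintype γ] : Type :=
  ⨁ β : Word φ, ⨂[ℝ] _ : Fin (β.1 + 1), Coeff γ

/-- Substitution in a noncommutative polynomial: the monomial `Z₀ F_{β₁} Z₁ ⋯ F_{β_q} Z_q` is sent
to `(g Z₀) * (f β₁ * g Z₁) * ⋯ * (f β_q * g Z_q)`. -/
def NCPoly.subst {γ φ : Type} [Fintype γ] {A : Type} [Ring A] [Algebra ℝ A]
    (g : Coeff γ →ₐ[ℝ] A) (f : φ → A) : NCPoly γ φ →ₗ[ℝ] A :=
  open Classical in
  DirectSum.toModule ℝ (Word φ) A fun β =>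
    PiTensorProduct.lift ((MultilinearMap.mkPiAlgebraFin ℝ (β.1 + 1) A).compLinearMap fun k =>
      (LinearMap.mulLeft ℝ ((Fin.cons 1 fun j => f (β.2 j) : Fin (β.1 + 1) → A) k)).comp
        g.toLinearMap)

/-- The abelianization `S_C` of a noncommutative polynomial `S`: a commutative polynomial in the
`F_i` whose coefficients are smooth functions of the `G_j`. -/
def NCPoly.abel {γ φ : Type} [Fintype γ] (S : NCPoly γ φ) : MvPolynomial φ (Coeff γ) :=
  NCPoly.subst (IsScalarTower.toAlgHom ℝ (Coeff γ) (MvPolynomial φ (Coeff γ))) MvPolynomial.X S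

/-- The value at `(G, F) = (a, b)` of a commutative polynomial in the `F_i` whose coefficients are
smooth functions of the `G_j`. -/
def commEval {γ φ : Type} [Fintype γ] (P : MvPolynomial φ (Coeff γ)) (a : γ → ℝ) (b : φ → ℝ) : ℝ :=
  MvPolynomial.eval₂ ((Pi.evalRingHom (fun _ : γ → ℝ => ℝ) a).comp
    (coeffSubalgebra γ).val.toRingHom) b P

/-- The weight `w_{β₁} + ⋯ + w_{β_q}` of a finite sequence of indices. -/
def Word.weight {φ : Type} (w : φ → ℕ) (β : Word φ) : ℕ := ∑ j, w (β.2 j)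

/-- The quasi-homogeneous part of degree `d` with weights `w`. -/
def NCPoly.quasiHomPart {γ φ : Type} [Fintype γ] (w : φ → ℕ) (d : ℕ) (S : NCPoly γ φ) :
    NCPoly γ φ :=
  open Classical in DFinsupp.filter (fun β => Word.weight w β = d) S

/-- The degree with weights `w`, the largest degree of a nonzero quasi-homogeneous part. -/
def NCPoly.deg {γ φ : Type} [Fintype γ] (w : φ → ℕ) (S : NCPoly γ φ) : ℕ :=
  open Classical in (DFinsupp.support S).sup (Word.weight w)

/-- The main part with weights `w`. -/
def NCPoly.mainPart {γ φ : Type} [Fintype γ] (w : φ → ℕ) (S : NCPoly γ φ) : NCPoly γ φ :=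
  NCPoly.quasiHomPart w (NCPoly.deg w S) S

/-! ### Noncommutative polynomials of a family of operators

For a finite family `V` of operators, the commuting variables correspond to the members of order
zero (the multiplication operators), the noncommutative symbols to those of positive order. -/

/-- The indices of the multiplication operators of the family. -/
abbrev IdxG {n : ℕ} {K : Opens (Fin n → ℝ)} {ι : Type} (V : ι → DiffOp K) : Type :=
  {i : ι // ord (V i) = 0}

/-- The indices of the operators of positive order of the family. -/
abbrev IdxF {n : ℕ} {K : Opens (Fin n → ℝ)} {ι : Type} (V : ι → DiffOp K) : Type :=
  {i : ι // ord (V i) ≠ 0}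

/-- The class of noncommutative polynomials that can be evaluated at the family `V`. -/
abbrev PolyFor {n : ℕ} {K : Opens (Fin n → ℝ)} {ι : Type} [Fintype ι] (V : ι → DiffOp K) : Type :=
  NCPoly (IdxG V) (IdxF V)

/-- For smooth functions `g_j` on `K`, the homomorphism `Z ↦ Z(g)` into `C^∞(K)`. -/
def compSmooth {n : ℕ} {K : Opens (Fin n → ℝ)} {γ : Type} [Fintype γ] (g : γ → Smooth K) :
    Coeff γ →ₐ[ℝ] Smooth K where
  toFun Z := ⟨fun x => Z.1 fun j => (g j).1 x, contDiffOn_ext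
    (g := fun x => Z.1 fun j => ext (g j).1 x)
    (ContDiff.comp_contDiffOn (g := Z.1) (show ContDiff ℝ ∞ Z.1 from Z.2)
      (contDiffOn_pi.2 fun j => (g j).2))
    fun x => by simp [ext_apply]⟩
  map_one' := rfl
  map_mul' _ _ := rfl
  map_zero' := rfl
  map_add' _ _ := rfl
  commutes' _ := rfl

/-- The operator `S(V)` obtained by substituting the operators `V` for the variables of `S`. A
member of order zero is multiplication by its symbol, which is the coefficient of `p⁰`. -/
def evalOp {n : ℕ} {K : Opens (Fin n → ℝ)} {ι : Type} [Fintype ι] (V : ι → DiffOp K)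
    (S : PolyFor V) : Module.End ℝ (Smooth K) :=
  NCPoly.subst ((Algebra.lmul ℝ (Smooth K)).comp
    (compSmooth fun j : IdxG V => (symbol (V j.1)).coeff 0)) (fun i : IdxF V => (V i.1).1) S

/-- The function `(ℳ_V S)_C`, the abelianization of the main part of `S` with respect to `V` (the
weights are the orders of the operators), as a real function of all the variables. -/
def mainFun {n : ℕ} {K : Opens (Fin n → ℝ)} {ι : Type} [Fintype ι] (V : ι → DiffOp K)
    (S : PolyFor V) : (ι → ℝ) → ℝ :=
  fun u => commEval (NCPoly.abel (NCPoly.mainPart (fun i : IdxF V => ord (V i.1)) S))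
    (fun j => u j.1) (fun i => u i.1)

/-! ### Dependence of sets of operators -/

/-- The phase space `K × ℝⁿ_p`. -/
abbrev Phase {n : ℕ} (K : Opens (Fin n → ℝ)) : Type := K × (Fin n → ℝ)

/-- A point of phase space as a point of `ℝⁿ × ℝⁿ`. -/
def Phase.pt {n : ℕ} {K : Opens (Fin n → ℝ)} (z : Phase K) : (Fin n → ℝ) × (Fin n → ℝ) :=
  (z.1.1, z.2)

/-- `W` is algebraically dependent on `Y` at the point `z = (x̄, p̄)`. -/
def AlgDependent {n : ℕ} {K : Opens (Fin n → ℝ)} (z : Phase K) {s r : ℕ}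
    (W : Fin s → DiffOp K) (Y : Fin r → DiffOp K) : Prop :=
  ∃ S : Fin s → PolyFor (Sum.elim W Y),
    (Matrix.of fun i h : Fin s => fderiv ℝ (mainFun (Sum.elim W Y) (S i))
      (fun k => mainSymbol (Sum.elim W Y k) z.pt) (Pi.single (Sum.inl h) 1)).det ≠ 0 ∧
    ∃ H ∈ 𝓝 z.1, ∀ i, ∀ ψ : Smooth K, ∀ x ∈ H, (evalOp (Sum.elim W Y) (S i) ψ).1 x = 0

/-- `W ⊑ Y` at the point `z`: there is a finite chain of finite sets of operators from `W` to `Y`,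
each algebraically dependent on the next one at `z`. -/
def AlgContained {n : ℕ} {K : Opens (Fin n → ℝ)} (z : Phase K) {s r : ℕ}
    (W : Fin s → DiffOp K) (Y : Fin r → DiffOp K) : Prop :=
  Relation.TransGen (fun A B : Σ q : ℕ, (Fin q → DiffOp K) => AlgDependent z A.2 B.2)
    ⟨s, W⟩ ⟨r, Y⟩

/-- The operators `W₁, …, W_s` are regularly dependent at the point `z`. -/
def RegularlyDependent {n : ℕ} {K : Opens (Fin n → ℝ)} {s : ℕ} (W : Fin s → DiffOp K)
    (z : Phase K) : Prop :=
  ∃ r < s, ∃ Y : Fin r → DiffOp K, AlgContained z W Y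

/-- The rank of the set of operators `W` at the point `z`. -/
def rank {n : ℕ} {K : Opens (Fin n → ℝ)} {s : ℕ} (W : Fin s → DiffOp K) (z : Phase K) : ℕ :=
  sInf {r | ∃ Y : Fin r → DiffOp K, AlgContained z W Y}

/-- The main dimension `r_W(z)` of the set of operators `W` at the point `z`. -/
def mainDim {n : ℕ} {K : Opens (Fin n → ℝ)} {s : ℕ} (W : Fin s → DiffOp K) (z : Phase K) : ℕ :=
  Module.finrank ℝ (Submodule.span ℝ (Set.range fun i => fderiv ℝ (mainSymbol (W i)) z.pt))

end DiffOps

end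

/-! The symbol calculus is carried one order below the usual one. If operators have leading parts
`a`, `b` and next parts `a'`, `b'`, their product has leading part `ab` and next part `ab' + a'b +
{a,b}⁺` (`HasLeading.mul`). Hence for a noncommutative polynomial `S` of degree `k` in a family `V`,
with `f = (ℳ_V S)_C`, the degree `k` part of the symbol of `S(V)` is `f(MV)`. The degree `k - 1`
part is `∑ ∂ᵢf(MV) M'Vᵢ + ∑ Bᵢⱼ(MV) {MVᵢ,MVⱼ}⁺ + g(MV)` with smooth `Bᵢⱼ` and `g`
(`hasExpansion_mainFun`).

If `S(V)` vanishes near the base point, both parts vanish on an open set and can be differentiated.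
With the same coefficients `∂ᵢf`, the `d(MVᵢ)` combine to zero and the `d(M'Vᵢ)` combine to an
element of the span of the `d(MVᵢ)` and `d{MVᵢ,MVⱼ}⁺`. When `W` is algebraically dependent on `Y`,
the determinant condition solves these relations for `W`: one matrix `T` gives `d(MW) = T d(MY)`,
and `d(M'W) = T d(M'Y)` modulo that span for the joint family (`AlgDependent.exists_coeff`).

So main spans grow along a chain from `W` to `Y`. As `Y` has `r < s` members and `W` has main
dimension `s - 1`, it follows that `r = s - 1`, and all main spans of the chain coincide. Algebraic
dependence is an open condition, so this persists nearby and also gives the rank. Consequently the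
main symbols of all the sets in the chain have differentials in the span of a fixed independent
subfamily of the `d(MWᵢ)`, and the differentials of their semi-brackets lie in the span attached to
`W` alone (`fderiv_semiBracket_mem_span`). A relation `γ` among the `d(MWᵢ)` is then pushed along
the chain by the matrices `T`. It becomes zero at `Y`, whose main differentials are independent, so
`∑ γᵢ d(M'Wᵢ)` differs from zero only by elements of that span. -/

noncomputable section

namespace DiffOps

section SymbolCalculus

/-! ### Polynomials whose coefficients carry derivations -/

variable {σ R E : Type*} [CommSemiring R]

/-- The polynomials whose monomials have degrees in the set `s`. -/
def degSupp (σ R : Type*) [CommSemiring R] (s : Set ℤ) : AddSubmonoid (MvPolynomial σ R) where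
  carrier := {P | ∀ α, P.coeff α ≠ 0 → (α.degree : ℤ) ∈ s}
  zero_mem' := fun α h => absurd (MvPolynomial.coeff_zero α) h
  add_mem' := fun {P Q} hP hQ α h => by
    by_cases hp : P.coeff α = 0
    · exact hQ α fun hq => h (by rw [MvPolynomial.coeff_add, hp, hq, add_zero])
    · exact hP α hp

theorem degSupp_mono {s t : Set ℤ} (h : s ⊆ t) : degSupp σ R s ≤ degSupp σ R t :=
  fun _ hP α hα => h (hP α hα)

theorem mul_mem_degSupp {s t u : Set ℤ} (h : ∀ a ∈ s, ∀ b ∈ t, a + b ∈ u)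
    {P Q : MvPolynomial σ R} (hP : P ∈ degSupp σ R s) (hQ : Q ∈ degSupp σ R t) :
    P * Q ∈ degSupp σ R u := by
  classical
  intro α hα
  rw [MvPolynomial.coeff_mul] at hα
  obtain ⟨x, hx, hne⟩ := Finset.exists_ne_zero_of_sum_ne_zero hα
  have hx : x.1 + x.2 = α := by simpa using hx
  have h1 := hP _ (left_ne_zero_of_mul hne)
  have h2 := hQ _ (right_ne_zero_of_mul hne)
  rw [← hx, map_add, Nat.cast_add]
  exact h _ h1 _ h2

theorem monomial_mem_degSupp {s : Set ℤ} {α : σ →₀ ℕ} (h : (α.degree : ℤ) ∈ s) (a : R) :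
    MvPolynomial.monomial α a ∈ degSupp σ R s := by
  classical
  intro β hβ
  rw [MvPolynomial.coeff_monomial] at hβ
  split_ifs at hβ with h1
  · exact h1 ▸ h
  · exact absurd rfl hβ

/-- Integer degrees allow bounds such as `k - 1` and `k - 2` for every `k`; a polynomial with a
negative degree bound is simply zero. -/
theorem pderiv_mem_degSupp {s t : Set ℤ} (h : ∀ a ∈ s, a - 1 ∈ t) (i : σ)
    {P : MvPolynomial σ R} (hP : P ∈ degSupp σ R s) :
    MvPolynomial.pderiv i P ∈ degSupp σ R t := by
  intro α hα
  rw [MvPolynomial.coeff_pderiv] at hα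
  have h1 := h _ (hP _ (left_ne_zero_of_mul hα))
  rw [map_add, Finsupp.degree_single] at h1
  simpa using h1

theorem coeff_sum_monomial_map (D : R →+ R) (P : MvPolynomial σ R) (β : σ →₀ ℕ) :
    (∑ α ∈ P.support, MvPolynomial.monomial α (D (P.coeff α))).coeff β = D (P.coeff β) := by
  classical
  simp only [MvPolynomial.coeff_sum, MvPolynomial.coeff_monomial]
  rw [Finset.sum_ite_eq' P.support β]
  split_ifs with h
  · rfl
  · rw [MvPolynomial.notMem_support_iff.1 h, map_zero]

/-- The additive map `D` applied to the coefficients of a polynomial. -/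
def mapCoeff (D : R →+ R) : MvPolynomial σ R →+ MvPolynomial σ R where
  toFun P := ∑ α ∈ P.support, MvPolynomial.monomial α (D (P.coeff α))
  map_zero' := by simp
  map_add' P Q := by
    ext1 β
    rw [MvPolynomial.coeff_add, coeff_sum_monomial_map, coeff_sum_monomial_map,
      coeff_sum_monomial_map, MvPolynomial.coeff_add, map_add]

theorem coeff_mapCoeff (D : R →+ R) (P : MvPolynomial σ R) (β : σ →₀ ℕ) :
    (mapCoeff D P).coeff β = D (P.coeff β) :=
  coeff_sum_monomial_map D P β

theorem mapCoeff_monomial (D : R →+ R) (α : σ →₀ ℕ) (a : R) :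
    mapCoeff D (MvPolynomial.monomial α a) = MvPolynomial.monomial α (D a) := by
  classical
  ext1 β
  rw [coeff_mapCoeff, MvPolynomial.coeff_monomial, MvPolynomial.coeff_monomial]
  split_ifs
  · rfl
  · rw [map_zero]

theorem mapCoeff_mem_degSupp {s : Set ℤ} (D : R →+ R) {P : MvPolynomial σ R}
    (hP : P ∈ degSupp σ R s) : mapCoeff D P ∈ degSupp σ R s := by
  intro α hα
  rw [coeff_mapCoeff] at hα
  exact hP α fun h => hα (by rw [h, map_zero])

theorem mapCoeff_mul (D : R →+ R) (hD : ∀ a b, D (a * b) = a * D b + D a * b)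
    (P Q : MvPolynomial σ R) :
    mapCoeff D (P * Q) = P * mapCoeff D Q + mapCoeff D P * Q := by
  induction P using MvPolynomial.induction_on' with
  | add P P' h h' => rw [add_mul, map_add, map_add, h, h']; ring
  | monomial α a =>
    induction Q using MvPolynomial.induction_on' with
    | add P P' h h' => rw [mul_add, map_add, map_add, h, h']; ring
    | monomial β b =>
      simp only [MvPolynomial.monomial_mul, mapCoeff_monomial, hD, map_add]

/-- The semi-bracket `∑ᵢ ∂a/∂pᵢ Dᵢ b` of polynomials. -/
def symBracket [Fintype σ] (D : σ → R →+ R) (a b : MvPolynomial σ R) : MvPolynomial σ R :=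
  ∑ i, MvPolynomial.pderiv i a * mapCoeff (D i) b

theorem symBracket_mem_degSupp [Fintype σ] {D : σ → R →+ R} {s t u : Set ℤ}
    (h : ∀ a ∈ s, ∀ b ∈ t, a + b - 1 ∈ u)
    {P Q : MvPolynomial σ R} (hP : P ∈ degSupp σ R s) (hQ : Q ∈ degSupp σ R t) :
    symBracket D P Q ∈ degSupp σ R u := by
  refine AddSubmonoid.sum_mem _ fun i _ => mul_mem_degSupp (s := (· - 1) '' s) (t := t) ?_
    (pderiv_mem_degSupp (fun a ha => Set.mem_image_of_mem _ ha) i hP) (mapCoeff_mem_degSupp _ hQ)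
  rintro _ ⟨a, ha, rfl⟩ b hb
  have := h a ha b hb
  simpa [show a - 1 + b = a + b - 1 by ring] using this

theorem symBracket_add_left [Fintype σ] (D : σ → R →+ R) (a a' b : MvPolynomial σ R) :
    symBracket D (a + a') b = symBracket D a b + symBracket D a' b := by
  simp [symBracket, add_mul, Finset.sum_add_distrib]

theorem symBracket_add_right [Fintype σ] (D : σ → R →+ R) (a b b' : MvPolynomial σ R) :
    symBracket D a (b + b') = symBracket D a b + symBracket D a b' := by
  simp [symBracket, mul_add, Finset.sum_add_distrib]

theorem symBracket_C_mul_left [Fintype σ] (D : σ → R →+ R) (c : R) (a b : MvPolynomial σ R) :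
    symBracket D (MvPolynomial.C c * a) b = MvPolynomial.C c * symBracket D a b := by
  simp [symBracket, Finset.mul_sum, MvPolynomial.C_mul']

theorem symBracket_X_mul_left [Fintype σ] (D : σ → R →+ R) (i : σ) (a b : MvPolynomial σ R) :
    symBracket D (MvPolynomial.X i * a) b =
      MvPolynomial.X i * symBracket D a b + a * mapCoeff (D i) b := by
  classical
  simp only [symBracket, Derivation.leibniz, smul_eq_mul, add_mul, Finset.sum_add_distrib,
    Finset.mul_sum, MvPolynomial.pderiv_X, Pi.single_apply, mul_ite, mul_one, mul_zero, ite_mul,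
    zero_mul, mul_assoc]
  simp

/-! ### Quantizations -/

variable [Semiring E]

/-- A quantization of polynomials in `p` over a ring with derivations `Dᵢ`: coefficients stand
on the left and `pᵢ` acts on the left by `p̂ᵢ` with `p̂ᵢ a = a p̂ᵢ + Dᵢ a`. -/
structure IsQuantization (D : σ → R →+ R) (m : R → E) (d : σ → E) (q : MvPolynomial σ R →+ E) :
    Prop where
  leibniz : ∀ i a b, D i (a * b) = a * D i b + D i a * b
  map_one : ∀ i, D i 1 = 0
  one : q 1 = 1
  C_mul : ∀ a P, m a * q P = q (MvPolynomial.C a * P)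
  X_mul : ∀ i P, d i * q P = q (MvPolynomial.X i * P + mapCoeff (D i) P)

variable {D : σ → R →+ R} {m : R → E} {d : σ → E} {q : MvPolynomial σ R →+ E}

theorem exists_eq_add_single {α : σ →₀ ℕ} {N : ℕ} (h : α.degree = N + 1) :
    ∃ (β : σ →₀ ℕ) (i : σ), α = β + Finsupp.single i 1 ∧ β.degree = N := by
  classical
  have hne : α ≠ 0 := fun h0 => by rw [h0, map_zero] at h; omega
  obtain ⟨i, hi⟩ := Finsupp.ne_iff.1 hne
  have hle : Finsupp.single i 1 ≤ α := by
    rw [Finsupp.single_le_iff]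
    exact Nat.one_le_iff_ne_zero.2 (by simpa using hi)
  refine ⟨α - Finsupp.single i 1, i, (tsub_add_cancel_of_le hle).symm, ?_⟩
  have h2 := congrArg Finsupp.degree (tsub_add_cancel_of_le hle)
  rw [map_add, Finsupp.degree_single] at h2
  omega

/-- Induction on the degree of `α`, peeling off one `pᵢ`. Moving `p̂ᵢ` past the coefficients of `b`
costs one degree and produces `Dᵢ b`, the new term of the semi-bracket; everything differentiated
twice has lost two degrees and goes into `r`. -/
theorem IsQuantization.monomial_one_mul [Fintype σ] (hq : IsQuantization D m d q) (α : σ →₀ ℕ) (l : ℤ)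
    {b : MvPolynomial σ R} (hb : b ∈ degSupp σ R (Set.Iic l)) :
    ∃ r ∈ degSupp σ R (Set.Iic (α.degree + l - 2)),
      q (MvPolynomial.monomial α 1) * q b = q (MvPolynomial.monomial α 1 * b +
          symBracket D (MvPolynomial.monomial α 1) b + r) := by
  obtain ⟨N, hN⟩ : ∃ N, α.degree = N := ⟨_, rfl⟩
  induction N generalizing α with
  | zero =>
    have h0 : α = 0 := (Finsupp.degree_eq_zero_iff α).1 hN
    subst h0
    refine ⟨0, zero_mem _, ?_⟩
    have h1 : symBracket D (MvPolynomial.monomial (0 : σ →₀ ℕ) (1 : R)) b = 0 := by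
      simp [symBracket]
    have h2 : (MvPolynomial.monomial (0 : σ →₀ ℕ) (1 : R)) = 1 := rfl
    rw [h1, h2, hq.one, one_mul, one_mul, add_zero, add_zero]
  | succ N ih =>
    obtain ⟨β, i, rfl, hβ⟩ := exists_eq_add_single hN
    obtain ⟨r, hr, heq⟩ := ih β hβ
    have hX : MvPolynomial.monomial (β + Finsupp.single i 1) (1 : R) =
        MvPolynomial.X i * MvPolynomial.monomial β 1 := by
      rw [MvPolynomial.X, MvPolynomial.monomial_mul, one_mul, add_comm]
    have hD : mapCoeff (D i) (MvPolynomial.monomial β (1 : R)) = 0 := by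
      rw [mapCoeff_monomial, hq.map_one, map_zero]
    have hd : q (MvPolynomial.monomial (β + Finsupp.single i 1) (1 : R)) =
        d i * q (MvPolynomial.monomial β 1) := by
      rw [hq.X_mul, hD, add_zero, hX]
    have hXm : (MvPolynomial.X i : MvPolynomial σ R) ∈ degSupp σ R {1} :=
      monomial_mem_degSupp (by simp) 1
    have hβm : MvPolynomial.monomial β (1 : R) ∈ degSupp σ R {(N : ℤ)} :=
      monomial_mem_degSupp (by simp [hβ]) 1
    -- The new remainder: `pᵢ` times the old one, the second derivatives obtained by applying `Dᵢ`
    -- to the old semi-bracket, and `Dᵢ` of the old remainder.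
    refine ⟨MvPolynomial.X i * r + mapCoeff (D i) (symBracket D (MvPolynomial.monomial β 1) b) +
      mapCoeff (D i) r, add_mem (add_mem ?_ (mapCoeff_mem_degSupp _ ?_))
        (mapCoeff_mem_degSupp _ ?_), ?_⟩
    · refine mul_mem_degSupp ?_ hXm hr
      rintro _ rfl y hy
      rw [Set.mem_Iic] at *
      omega
    · refine symBracket_mem_degSupp ?_ hβm hb
      rintro _ rfl y hy
      rw [Set.mem_Iic] at *
      omega
    · refine degSupp_mono (Set.Iic_subset_Iic.2 ?_) hr
      omega
    · rw [hd, mul_assoc, heq, hq.X_mul, hX, symBracket_X_mul_left]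
      congr 1
      rw [map_add, map_add, mapCoeff_mul _ (hq.leibniz i), hD]
      ring

/-- Coefficients of `a` stand on the left and pass through `q`, so the monic monomials of `a`
suffice. -/
theorem IsQuantization.mul_of_le [Fintype σ] (hq : IsQuantization D m d q) (k l : ℤ)
    {a b : MvPolynomial σ R} (ha : a ∈ degSupp σ R (Set.Iic k))
    (hb : b ∈ degSupp σ R (Set.Iic l)) :
    ∃ r ∈ degSupp σ R (Set.Iic (k + l - 2)), q a * q b = q (a * b + symBracket D a b + r) := by
  classical
  choose r hr heq using fun α : σ →₀ ℕ => hq.monomial_one_mul α l hb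
  have hC : ∀ (α : σ →₀ ℕ) (c : R),
      MvPolynomial.monomial α c = MvPolynomial.C c * MvPolynomial.monomial α 1 := fun α c => by
    rw [MvPolynomial.C_mul_monomial, mul_one]
  have hbr : ∀ (t : Finset (σ →₀ ℕ)) (f : (σ →₀ ℕ) → MvPolynomial σ R),
      symBracket D (∑ α ∈ t, f α) b = ∑ α ∈ t, symBracket D (f α) b := fun t f =>
    map_sum (⟨⟨fun a => symBracket D a b, by simp [symBracket]⟩,
      fun a a' => symBracket_add_left D a a' b⟩ : MvPolynomial σ R →+ MvPolynomial σ R) f t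
  refine ⟨∑ α ∈ a.support, MvPolynomial.C (a.coeff α) * r α, sum_mem fun α hα => ?_, ?_⟩
  · have h1 : (α.degree : ℤ) ≤ k := ha α (MvPolynomial.mem_support_iff.1 hα)
    refine mul_mem_degSupp (s := {0}) ?_ (monomial_mem_degSupp (by simp) _) (hr α)
    rintro _ rfl y hy
    rw [Set.mem_Iic] at *
    omega
  · have hsum : a * b + symBracket D a b + ∑ α ∈ a.support, MvPolynomial.C (a.coeff α) * r α =
        ∑ α ∈ a.support, MvPolynomial.C (a.coeff α) * (MvPolynomial.monomial α 1 * b +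
          symBracket D (MvPolynomial.monomial α 1) b + r α) := by
      simp only [mul_add, Finset.sum_add_distrib]
      congr 2
      · conv_lhs => rw [a.as_sum, Finset.sum_mul]
        exact Finset.sum_congr rfl fun α _ => by rw [hC, mul_assoc]
      · conv_lhs => rw [a.as_sum, hbr]
        exact Finset.sum_congr rfl fun α _ => by rw [hC, symBracket_C_mul_left]
    rw [hsum, map_sum]
    conv_lhs => rw [a.as_sum, map_sum, Finset.sum_mul]
    refine Finset.sum_congr rfl fun α _ => ?_
    rw [hC, ← hq.C_mul, mul_assoc, heq, hq.C_mul]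

/-! ### Leading and next-to-leading parts -/

/-- The element `A` is quantized from a polynomial with homogeneous part `a` of degree `k`,
homogeneous part `a'` of degree `k - 1`, and other parts of smaller degrees. -/
def HasLeading (q : MvPolynomial σ R →+ E) (k : ℤ) (a a' : MvPolynomial σ R) (A : E) : Prop :=
  a ∈ degSupp σ R {k} ∧ a' ∈ degSupp σ R {k - 1} ∧
    ∃ r ∈ degSupp σ R (Set.Iic (k - 2)), A = q (a + a' + r)

theorem HasLeading.add {k : ℤ} {a a' b b' : MvPolynomial σ R} {A B : E}
    (hA : HasLeading q k a a' A) (hB : HasLeading q k b b' B) :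
    HasLeading q k (a + b) (a' + b') (A + B) := by
  obtain ⟨ha, ha', r, hr, rfl⟩ := hA
  obtain ⟨hb, hb', s, hs, rfl⟩ := hB
  refine ⟨add_mem ha hb, add_mem ha' hb', r + s, add_mem hr hs, ?_⟩
  rw [← map_add]
  congr 1
  ring

theorem HasLeading.succ {k : ℤ} {a a' : MvPolynomial σ R} {A : E}
    (hA : HasLeading q k a a' A) : HasLeading q (k + 1) 0 a A := by
  obtain ⟨ha, ha', r, hr, rfl⟩ := hA
  refine ⟨zero_mem _, by simpa using ha, a' + r, ?_, ?_⟩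
  · refine add_mem (degSupp_mono ?_ ha') (degSupp_mono ?_ hr)
    · rintro x rfl
      rw [Set.mem_Iic]; omega
    · intro x hx
      rw [Set.mem_Iic] at *; omega
  · congr 1
    ring

/-- The three summands live in disjoint ranges of degrees, so nothing cancels and `a`, `a'` can be
read off from the symbol. -/
theorem HasLeading.exists_coeff_eq {k : ℤ} {a a' : MvPolynomial σ R} {A : E}
    (hA : HasLeading q k a a' A) : ∃ P, A = q P ∧
      ∀ α, (a.coeff α ≠ 0 → P.coeff α = a.coeff α) ∧
        (a'.coeff α ≠ 0 → P.coeff α = a'.coeff α) := by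
  obtain ⟨ha, ha', r, hr, rfl⟩ := hA
  refine ⟨_, rfl, fun α => ⟨fun h => ?_, fun h => ?_⟩⟩
  · have h1 := ha α h
    have h2 : a'.coeff α = 0 := by
      by_contra h2
      have := ha' α h2
      rw [Set.mem_singleton_iff] at h1 this
      omega
    have h3 : r.coeff α = 0 := by
      by_contra h3
      have := hr α h3
      rw [Set.mem_singleton_iff] at h1
      rw [Set.mem_Iic] at this
      omega
    rw [MvPolynomial.coeff_add, MvPolynomial.coeff_add, h2, h3, add_zero, add_zero]
  · have h1 := ha' α h
    have h2 : a.coeff α = 0 := by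
      by_contra h2
      have := ha α h2
      rw [Set.mem_singleton_iff] at h1 this
      omega
    have h3 : r.coeff α = 0 := by
      by_contra h3
      have := hr α h3
      rw [Set.mem_singleton_iff] at h1
      rw [Set.mem_Iic] at this
      omega
    rw [MvPolynomial.coeff_add, MvPolynomial.coeff_add, h2, h3, zero_add, add_zero]

theorem homogeneousComponent_mem_degSupp {s : Set ℤ} {k : ℕ} (hk : (k : ℤ) ∈ s)
    (P : MvPolynomial σ R) : MvPolynomial.homogeneousComponent k P ∈ degSupp σ R s := by
  classical
  intro α hα
  rw [MvPolynomial.coeff_homogeneousComponent] at hα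
  split_ifs at hα with h
  · exact h ▸ hk
  · exact absurd rfl hα

theorem hasLeading_homogeneousComponent (q : MvPolynomial σ R →+ E) (P : MvPolynomial σ R)
    (h : 0 < P.totalDegree) :
    HasLeading q P.totalDegree (MvPolynomial.homogeneousComponent P.totalDegree P)
      (MvPolynomial.homogeneousComponent (P.totalDegree - 1) P) (q P) := by
  obtain ⟨k, hk⟩ : ∃ k, P.totalDegree = k + 1 := ⟨P.totalDegree - 1, by omega⟩
  refine ⟨homogeneousComponent_mem_degSupp (Set.mem_singleton _) P, homogeneousComponent_mem_degSupp ?_ P,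
    ∑ i ∈ Finset.range k, MvPolynomial.homogeneousComponent i P, sum_mem fun i hi =>
      homogeneousComponent_mem_degSupp ?_ P, ?_⟩
  · rw [Set.mem_singleton_iff]
    omega
  · rw [Finset.mem_range] at hi
    rw [Set.mem_Iic]
    omega
  · congr 1
    conv_lhs => rw [← MvPolynomial.sum_homogeneousComponent P, hk, Finset.sum_range_succ,
      Finset.sum_range_succ]
    rw [hk, Nat.add_sub_cancel]
    ring

theorem HasLeading.mul [Fintype σ] (hq : IsQuantization D m d q) {k l : ℤ} {a a' b b' : MvPolynomial σ R}
    {A B : E} (hA : HasLeading q k a a' A) (hB : HasLeading q l b b' B) :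
    HasLeading q (k + l) (a * b) (a * b' + a' * b + symBracket D a b) (A * B) := by
  obtain ⟨ha, ha', r, hr, rfl⟩ := hA
  obtain ⟨hb, hb', s, hs, rfl⟩ := hB
  have hsub : ∀ {k : ℤ}, ({k} : Set ℤ) ⊆ Set.Iic k := fun {k} x hx => by
    rw [Set.mem_singleton_iff] at hx; rw [Set.mem_Iic]; omega
  have hle : ∀ {i j : ℤ}, i ≤ j → degSupp σ R (Set.Iic i) ≤ degSupp σ R (Set.Iic j) :=
    fun h => degSupp_mono (Set.Iic_subset_Iic.2 h)
  have hA' : a + a' + r ∈ degSupp σ R (Set.Iic k) :=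
    add_mem (add_mem (degSupp_mono hsub ha) (hle (by omega) (degSupp_mono hsub ha')))
      (hle (by omega) hr)
  have hB' : b + b' + s ∈ degSupp σ R (Set.Iic l) :=
    add_mem (add_mem (degSupp_mono hsub hb) (hle (by omega) (degSupp_mono hsub hb')))
      (hle (by omega) hs)
  obtain ⟨t, ht, heq⟩ := hq.mul_of_le k l hA' hB'
  have hmul : ∀ {i j x : ℤ} {P Q : MvPolynomial σ R}, P ∈ degSupp σ R {i} →
      Q ∈ degSupp σ R {j} → i + j = x → P * Q ∈ degSupp σ R {x} := fun hP hQ h =>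
    mul_mem_degSupp (by rintro _ rfl _ rfl; exact h) hP hQ
  have hmul' : ∀ {i j x : ℤ} {P Q : MvPolynomial σ R}, P ∈ degSupp σ R (Set.Iic i) →
      Q ∈ degSupp σ R (Set.Iic j) → i + j ≤ x → P * Q ∈ degSupp σ R (Set.Iic x) :=
    fun hP hQ h => mul_mem_degSupp (fun u hu v hv => by rw [Set.mem_Iic] at *; omega) hP hQ
  have hbr : ∀ {i j x : ℤ} {P Q : MvPolynomial σ R}, P ∈ degSupp σ R (Set.Iic i) →
      Q ∈ degSupp σ R (Set.Iic j) → i + j - 1 ≤ x → symBracket D P Q ∈ degSupp σ R (Set.Iic x) :=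
    fun hP hQ h => symBracket_mem_degSupp (fun u hu v hv => by rw [Set.mem_Iic] at *; omega) hP hQ
  have ha1 := degSupp_mono hsub ha
  have ha1' := degSupp_mono hsub ha'
  have hb1 := degSupp_mono hsub hb
  have hb1' := degSupp_mono hsub hb'
  refine ⟨hmul ha hb rfl, add_mem (add_mem (hmul ha hb' (by ring)) (hmul ha' hb (by ring)))
    (symBracket_mem_degSupp (by rintro _ rfl _ rfl; rfl) ha hb),
    -- Products in which at least two degrees are lost, then semi-brackets with a non-leading
    -- factor, then the remainder of the product formula.
    (a * s + a' * b' + a' * s + r * b + r * b' + r * s) +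
      (symBracket D a b' + symBracket D a s + symBracket D a' b + symBracket D a' b' +
        symBracket D a' s + symBracket D r b + symBracket D r b' + symBracket D r s) + t, ?_, ?_⟩
  · refine add_mem (add_mem ?_ ?_) ht
    · refine add_mem (add_mem (add_mem (add_mem (add_mem ?_ ?_) ?_) ?_) ?_) ?_ <;>
      refine hmul' (by assumption) (by assumption) (by omega)
    · refine add_mem (add_mem (add_mem (add_mem (add_mem (add_mem (add_mem ?_ ?_) ?_) ?_) ?_) ?_)
        ?_) ?_ <;>
      refine hbr (by assumption) (by assumption) (by omega)
  · rw [heq]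
    congr 1
    simp only [symBracket_add_left, symBracket_add_right]
    ring

end SymbolCalculus

/-! ### Symbols as functions on phase space -/

section PhaseFunctions

variable {n : ℕ} {K : Opens (Fin n → ℝ)}

/-- The standard quantization as an additive map. -/
def quantizeHom (K : Opens (Fin n → ℝ)) :
    MvPolynomial (Fin n) (Smooth K) →+ Module.End ℝ (Smooth K) :=
  ⟨⟨quantize, quantize_zero⟩, quantize_add⟩

/-- The derivations `∂/∂xᵢ` of `C^∞(K)` as additive maps. -/
def coeffDeriv (K : Opens (Fin n → ℝ)) (i : Fin n) : Smooth K →+ Smooth K :=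
  ⟨⟨pderiv i, map_zero _⟩, map_add _⟩

theorem isQuantization_quantizeHom : IsQuantization (coeffDeriv K) (Algebra.lmul ℝ (Smooth K))
    pderiv (quantizeHom K) where
  leibniz i a b := pderiv_mul i a b
  map_one i := by
    have h := pderiv_mul i (1 : Smooth K) 1
    rw [mul_one, one_mul, mul_one] at h
    exact left_eq_add.1 h
  one := by
    show quantize (MvPolynomial.monomial 0 1) = 1
    rw [quantize_monomial, map_one, one_mul]
    simp [pderivPow]
  C_mul a P := by
    show Algebra.lmul ℝ (Smooth K) a * quantize P = quantize (MvPolynomial.C a * P)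
    induction P using MvPolynomial.induction_on' with
    | add P Q h h' => rw [mul_add, quantize_add, quantize_add, mul_add, h, h']
    | monomial α b =>
      rw [MvPolynomial.C_mul_monomial, quantize_monomial, quantize_monomial, map_mul, mul_assoc]
  X_mul i P := by
    show pderiv i * quantize P = quantize (MvPolynomial.X i * P + mapCoeff (coeffDeriv K i) P)
    induction P using MvPolynomial.induction_on' with
    | add P Q h h' =>
      rw [map_add, mul_add, quantize_add, mul_add, h, h', ← quantize_add, add_add_add_comm]
    | monomial α a =>
      have hX : MvPolynomial.X i * MvPolynomial.monomial α a =
          MvPolynomial.monomial (α + Finsupp.single i 1) a := by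
        rw [MvPolynomial.X, MvPolynomial.monomial_mul, one_mul, add_comm]
      rw [hX, quantize_add, mapCoeff_monomial, quantize_monomial, quantize_monomial,
        quantize_monomial, ← pderiv_mul_pderivPow, ← mul_assoc, ← mul_assoc, ← add_mul]
      congr 1
      refine LinearMap.ext fun g => ?_
      exact pderiv_mul i a g

/-- The value of a smooth function at a point. -/
def valueAt (x : K) : Smooth K →+* ℝ :=
  (Pi.evalRingHom (fun _ : K => ℝ) x).comp (smoothSubalgebra K).val.toRingHom

theorem valueAt_apply (x : K) (a : Smooth K) : valueAt x a = a.1 x := rfl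

/-- The value of a polynomial in `p` with coefficients in `C^∞(K)` at a point of phase space. -/
def evalSym (z : Phase K) : MvPolynomial (Fin n) (Smooth K) →+* ℝ :=
  MvPolynomial.eval₂Hom (valueAt z.1) z.2

theorem polyFun_pt (P : MvPolynomial (Fin n) (Smooth K)) (z : Phase K) :
    polyFun P z.pt = evalSym z P := by
  show _ = MvPolynomial.eval₂ _ _ _
  rw [MvPolynomial.eval₂_eq']
  refine Finset.sum_congr rfl fun α _ => ?_
  rw [valueAt_apply, ← ext_apply (P.coeff α).1 z.1]
  rfl

theorem isOpenEmbedding_pt : IsOpenEmbedding (Phase.pt : Phase K → _) :=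
  K.isOpen.isOpenEmbedding_subtypeVal.prodMap IsOpenEmbedding.id

theorem eventually_nhds_pt {z : Phase K} {p : (Fin n → ℝ) × (Fin n → ℝ) → Prop} :
    (∀ᶠ w in 𝓝 z.pt, p w) ↔ ∀ᶠ y in 𝓝 z, p (Phase.pt y) := by
  rw [← isOpenEmbedding_pt.map_nhds_eq, Filter.eventually_map]

theorem contDiffAt_polyFun (P : MvPolynomial (Fin n) (Smooth K)) (z : Phase K) :
    ContDiffAt ℝ ∞ (polyFun P) z.pt := by
  refine ContDiffAt.sum fun α _ => ?_
  refine ContDiffAt.mul ?_ ?_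
  · exact (contDiffAt_ext (P.coeff α) z.1).comp z.pt contDiffAt_fst
  · fun_prop

/-- Identifies the formal derivatives of the symbol calculus with analytic ones, so that
`symBracket` evaluates to `semiBracket`. -/
theorem exists_hasFDerivAt_polyFun (P : MvPolynomial (Fin n) (Smooth K)) (z : Phase K) :
    ∃ L : (Fin n → ℝ) × (Fin n → ℝ) →L[ℝ] ℝ, HasFDerivAt (polyFun P) L z.pt ∧
      ∀ i, L (Pi.single i 1, 0) = evalSym z (mapCoeff (coeffDeriv K i) P) ∧
        L (0, Pi.single i 1) = evalSym z (MvPolynomial.pderiv i P) := by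
  induction P using MvPolynomial.induction_on with
  | C a =>
    refine ⟨(fderiv ℝ (ext a.1) z.1).comp (ContinuousLinearMap.fst ℝ _ _), ?_, fun i => ⟨?_, ?_⟩⟩
    · have h := HasFDerivAt.comp (f := Prod.fst) z.pt (g := ext a.1)
        (differentiableAt_ext a z.1).hasFDerivAt hasFDerivAt_fst
      refine h.congr_of_eventuallyEq (eventually_nhds_pt.2 (Eventually.of_forall fun y => ?_))
      rw [polyFun_pt]
      simp only [evalSym, MvPolynomial.coe_eval₂Hom, MvPolynomial.eval₂_C]
      exact (ext_apply a.1 y.1).symm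
    · have h : mapCoeff (coeffDeriv K i) (MvPolynomial.C a : MvPolynomial (Fin n) (Smooth K)) =
          MvPolynomial.C (pderiv i a) := mapCoeff_monomial _ _ _
      rw [h]
      simp only [evalSym, MvPolynomial.coe_eval₂Hom, MvPolynomial.eval₂_C]
      rfl
    · rw [MvPolynomial.pderiv_C, map_zero]
      simp
  | add P Q hP hQ =>
    obtain ⟨L, hL, h⟩ := hP
    obtain ⟨L', hL', h'⟩ := hQ
    refine ⟨L + L', (hL.add hL').congr_of_eventuallyEq
      (eventually_nhds_pt.2 (Eventually.of_forall fun y => ?_)), fun i => ⟨?_, ?_⟩⟩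
    · simp only [Pi.add_apply, polyFun_pt, map_add]
    · rw [map_add, map_add, ← (h i).1, ← (h' i).1]; rfl
    · rw [map_add, map_add, ← (h i).2, ← (h' i).2]; rfl
  | mul_X P j hP =>
    obtain ⟨L, hL, h⟩ := hP
    have hX : HasFDerivAt (fun w : (Fin n → ℝ) × (Fin n → ℝ) => w.2 j)
        ((ContinuousLinearMap.proj (R := ℝ) (φ := fun _ : Fin n => ℝ) j).comp
          (ContinuousLinearMap.snd ℝ _ _)) z.pt :=
      ((ContinuousLinearMap.proj (R := ℝ) (φ := fun _ : Fin n => ℝ) j).comp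
        (ContinuousLinearMap.snd ℝ (Fin n → ℝ) (Fin n → ℝ))).hasFDerivAt
    refine ⟨_, (hL.mul hX).congr_of_eventuallyEq
      (eventually_nhds_pt.2 (Eventually.of_forall fun y => ?_)), fun i => ⟨?_, ?_⟩⟩
    · simp only [Pi.mul_apply, polyFun_pt, map_mul]
      simp [evalSym, Phase.pt]
    · have h0 : mapCoeff (coeffDeriv K i) (MvPolynomial.X j : MvPolynomial (Fin n) (Smooth K)) =
          0 := by
        rw [MvPolynomial.X, mapCoeff_monomial, isQuantization_quantizeHom.map_one, map_zero]
      rw [mapCoeff_mul _ (isQuantization_quantizeHom.leibniz i), h0, mul_zero, zero_add, map_mul,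
        ← (h i).1]
      simp [evalSym, Phase.pt, mul_comm]
    · rw [MvPolynomial.pderiv_mul, MvPolynomial.pderiv_X, map_add, map_mul, map_mul, ← (h i).2]
      by_cases hij : j = i
      · subst hij
        have hp : polyFun P (Phase.pt z) = MvPolynomial.eval₂ (valueAt z.1) z.2 P :=
          polyFun_pt P z
        simp only [Pi.single_eq_same, map_one]
        simp only [Phase.pt] at hp
        simp [evalSym, Phase.pt, hp, mul_comm, add_comm]
      · simp [evalSym, Phase.pt, hij, mul_comm]

theorem fderiv_polyFun_fst (P : MvPolynomial (Fin n) (Smooth K)) (z : Phase K) (i : Fin n) :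
    fderiv ℝ (polyFun P) z.pt (Pi.single i 1, 0) = evalSym z (mapCoeff (coeffDeriv K i) P) := by
  obtain ⟨L, hL, h⟩ := exists_hasFDerivAt_polyFun P z
  rw [hL.fderiv, (h i).1]

theorem fderiv_polyFun_snd (P : MvPolynomial (Fin n) (Smooth K)) (z : Phase K) (i : Fin n) :
    fderiv ℝ (polyFun P) z.pt (0, Pi.single i 1) = evalSym z (MvPolynomial.pderiv i P) := by
  obtain ⟨L, hL, h⟩ := exists_hasFDerivAt_polyFun P z
  rw [hL.fderiv, (h i).2]

theorem evalSym_symBracket (P Q : MvPolynomial (Fin n) (Smooth K)) (z : Phase K) :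
    evalSym z (symBracket (coeffDeriv K) P Q) = semiBracket (polyFun P) (polyFun Q) z.pt := by
  rw [symBracket, map_sum]
  refine Finset.sum_congr rfl fun i _ => ?_
  rw [map_mul, fderiv_polyFun_fst, fderiv_polyFun_snd]

/-- Tested on `exp (l · x)`, the operator gives `P(x, l) exp (l · x)`. A polynomial in `l` that
vanishes identically has zero coefficients, so vanishing at the single point `x` is enough. -/
theorem valueAt_coeff_eq_zero {P : MvPolynomial (Fin n) (Smooth K)} {x : K}
    (h : ∀ ψ : Smooth K, (quantize P ψ).1 x = 0) (α : Fin n →₀ ℕ) : valueAt x (P.coeff α) = 0 := by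
  have hpow : ∀ (l : Fin n → ℝ) (α : Fin n →₀ ℕ),
      pderivPow α (expFun K l) = (∏ i, l i ^ α i) • expFun K l := by
    intro l α
    have h1 : ∀ (i : Fin n) (k : ℕ), (pderiv i ^ k) (expFun K l) = l i ^ k • expFun K l := by
      intro i k
      induction k with
      | zero => simp
      | succ k ih => rw [pow_succ', Module.End.mul_apply, ih, map_smul, pderiv_expFun, smul_smul,
          pow_succ]
    have h2 : ∀ L : List (Fin n), (L.map fun i => pderiv i ^ α i).prod (expFun K l) =
        (L.map fun i => l i ^ α i).prod • expFun K l := by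
      intro L
      induction L with
      | nil => simp
      | cons i L ih => rw [List.map_cons, List.map_cons, List.prod_cons, List.prod_cons,
          Module.End.mul_apply, ih, map_smul, h1, smul_smul, mul_comm]
    rw [pderivPow, h2, ← List.ofFn_eq_map, List.prod_ofFn]
  have hev : ∀ (R : MvPolynomial (Fin n) (Smooth K)) (l : Fin n → ℝ),
      (quantize R (expFun K l)).1 x = MvPolynomial.eval l
        (MvPolynomial.map (valueAt x) R) * (expFun K l).1 x := by
    intro R l
    induction R using MvPolynomial.induction_on' with
    | monomial α a =>
      rw [quantize_monomial, Module.End.mul_apply, hpow]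
      simp [MvPolynomial.eval_monomial, Finsupp.prod_fintype, valueAt_apply]
      ring
    | add R R' h h' =>
      rw [quantize_add]
      simp only [map_add, add_mul, ← h, ← h']
      rfl
  have hx : MvPolynomial.map (valueAt x) P = 0 := by
    refine MvPolynomial.funext fun l => ?_
    have h1 := hev P l
    rw [h] at h1
    rw [map_zero]
    exact (mul_eq_zero.1 h1.symm).resolve_right (Real.exp_pos _).ne'
  rw [← MvPolynomial.coeff_map, hx, MvPolynomial.coeff_zero]

theorem evalSym_eq_zero {P : MvPolynomial (Fin n) (Smooth K)} {z : Phase K}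
    (h : ∀ α, valueAt z.1 (P.coeff α) = 0) : evalSym z P = 0 := by
  show MvPolynomial.eval₂ _ _ _ = 0
  rw [MvPolynomial.eval₂_eq']
  exact Finset.sum_eq_zero fun α _ => by rw [h, zero_mul]

theorem HasLeading.evalSym_eq_zero {k : ℤ} {a a' : MvPolynomial (Fin n) (Smooth K)}
    {A : Module.End ℝ (Smooth K)} (hA : HasLeading (quantizeHom K) k a a' A) {z : Phase K}
    (h : ∀ ψ : Smooth K, (A ψ).1 z.1 = 0) : evalSym z a = 0 ∧ evalSym z a' = 0 := by
  obtain ⟨P, rfl, hP⟩ := hA.exists_coeff_eq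
  have h0 := valueAt_coeff_eq_zero h
  refine ⟨DiffOps.evalSym_eq_zero fun α => ?_, DiffOps.evalSym_eq_zero fun α => ?_⟩
  · by_cases hα : a.coeff α = 0
    · rw [hα, map_zero]
    · rw [← (hP α).1 hα, h0]
  · by_cases hα : a'.coeff α = 0
    · rw [hα, map_zero]
    · rw [← (hP α).2 hα, h0]

theorem contDiffAt_mainSymbol (F : DiffOp K) (z : Phase K) :
    ContDiffAt ℝ ∞ (mainSymbol F) z.pt :=
  contDiffAt_polyFun _ z

theorem contDiffAt_secondMainSymbol (F : DiffOp K) (z : Phase K) :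
    ContDiffAt ℝ ∞ (secondMainSymbol F) z.pt := by
  unfold secondMainSymbol
  split_ifs
  · exact contDiffAt_polyFun _ z
  · exact contDiffAt_const

theorem hasLeading_of_ord_pos (F : DiffOp K) (h : 0 < ord F) :
    HasLeading (quantizeHom K) (ord F)
      (MvPolynomial.homogeneousComponent (ord F) (symbol F))
      (MvPolynomial.homogeneousComponent (ord F - 1) (symbol F)) F.1 := by
  have h1 := hasLeading_homogeneousComponent (quantizeHom K) (symbol F) h
  rwa [show quantizeHom K (symbol F) = F.1 from quantize_symbol F] at h1

theorem contDiffAt_semiBracket {A B : (Fin n → ℝ) × (Fin n → ℝ) → ℝ}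
    {w : (Fin n → ℝ) × (Fin n → ℝ)} (hA : ContDiffAt ℝ ∞ A w) (hB : ContDiffAt ℝ ∞ B w) :
    ContDiffAt ℝ ∞ (semiBracket A B) w :=
  ContDiffAt.sum fun i _ => ((hA.fderiv_right (m := ∞) (by simp)).clm_apply contDiffAt_const).mul
    ((hB.fderiv_right (m := ∞) (by simp)).clm_apply contDiffAt_const)

end PhaseFunctions

/-! ### Leading parts of noncommutative polynomials of operators -/

section Calculus

variable {ι : Type*} [Fintype ι] [DecidableEq ι] {E : Type*} [NormedAddCommGroup E]
  [NormedSpace ℝ E]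

theorem fderiv_comp_family {f : (ι → ℝ) → ℝ} {v : E → ι → ℝ} {w : E}
    (hf : DifferentiableAt ℝ f (v w)) (hv : ∀ i, DifferentiableAt ℝ (fun y => v y i) w) :
    fderiv ℝ (fun y => f (v y)) w =
      ∑ i, fderiv ℝ f (v w) (Pi.single i 1) • fderiv ℝ (fun y => v y i) w := by
  have h := hf.hasFDerivAt.comp w (hasFDerivAt_pi.2 fun i => (hv i).hasFDerivAt)
  rw [show (fun y => f (v y)) = f ∘ v from rfl, h.fderiv]
  ext u
  have hu : (ContinuousLinearMap.pi fun i => fderiv ℝ (fun y => v y i) w) u =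
      ∑ i, fderiv ℝ (fun y => v y i) w u • (Pi.single i 1 : ι → ℝ) := by
    ext j
    simp [Finset.sum_apply, Pi.single_apply]
  rw [ContinuousLinearMap.comp_apply, hu, map_sum]
  simp [mul_comm]

end Calculus

/-! ### Expansions in the main symbols of a family -/

section Expansion

variable {n : ℕ} {K : Opens (Fin n → ℝ)} {ι : Type}

/-- The values of the main symbols of a family of operators. -/
def mainVals (V : ι → DiffOp K) (w : (Fin n → ℝ) × (Fin n → ℝ)) : ι → ℝ :=
  fun i => mainSymbol (V i) w

theorem differentiableAt_mainSymbol (F : DiffOp K) (z : Phase K) :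
    DifferentiableAt ℝ (mainSymbol F) z.pt :=
  (contDiffAt_mainSymbol F z).differentiableAt (by simp)

variable [Fintype ι]

theorem contDiffAt_mainVals (V : ι → DiffOp K) (z : Phase K) :
    ContDiffAt ℝ ∞ (mainVals V) z.pt :=
  contDiffAt_pi.2 fun i => contDiffAt_mainSymbol (V i) z

variable [DecidableEq ι]

theorem semiBracket_comp_mainVals (V : ι → DiffOp K) (z : Phase K) {f g : (ι → ℝ) → ℝ}
    (hf : ContDiff ℝ ∞ f) (hg : ContDiff ℝ ∞ g) :
    semiBracket (fun w => f (mainVals V w)) (fun w => g (mainVals V w)) z.pt =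
      ∑ i, ∑ j, fderiv ℝ f (mainVals V z.pt) (Pi.single i 1) *
        fderiv ℝ g (mainVals V z.pt) (Pi.single j 1) *
          semiBracket (mainSymbol (V i)) (mainSymbol (V j)) z.pt := by
  have hv : ∀ i, DifferentiableAt ℝ (fun y => mainVals V y i) z.pt := fun i =>
    differentiableAt_mainSymbol (V i) z
  have h1 := fderiv_comp_family (hf.differentiable (by simp)).differentiableAt hv
  have h2 := fderiv_comp_family (hg.differentiable (by simp)).differentiableAt hv
  unfold semiBracket
  rw [h1, h2]
  simp only [_root_.sum_apply, _root_.smul_apply, smul_eq_mul, Finset.sum_mul_sum]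
  simp only [Finset.mul_sum]
  rw [Finset.sum_comm]
  refine Finset.sum_congr rfl fun i _ => ?_
  rw [Finset.sum_comm]
  refine Finset.sum_congr rfl fun j _ => Finset.sum_congr rfl fun k _ => ?_
  show _ * fderiv ℝ (mainSymbol (V i)) z.pt _ * (_ * fderiv ℝ (mainSymbol (V j)) z.pt _) = _
  ring

/-- The operator `A` has degree at most `k`; the part of degree `k` of its symbol is `f (MV)`, and
the part of degree `k - 1` is `∑ ∂ᵢ f (MV) M'Vᵢ` up to a combination of the semi-brackets
`{MVᵢ, MVⱼ}⁺` and `1` whose coefficients are smooth functions of `MV`. -/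
def HasExpansion (V : ι → DiffOp K) (k : ℤ) (f : (ι → ℝ) → ℝ) (A : Module.End ℝ (Smooth K)) :
    Prop :=
  ContDiff ℝ ∞ f ∧ ∃ a a', HasLeading (quantizeHom K) k a a' A ∧
    ∃ (B : ι → ι → (ι → ℝ) → ℝ) (g : (ι → ℝ) → ℝ), (∀ i j, ContDiff ℝ ∞ (B i j)) ∧
      ContDiff ℝ ∞ g ∧ ∀ z : Phase K, evalSym z a = f (mainVals V z.pt) ∧
        evalSym z a' = ∑ i, fderiv ℝ f (mainVals V z.pt) (Pi.single i 1) *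
            secondMainSymbol (V i) z.pt +
          ∑ i, ∑ j, B i j (mainVals V z.pt) *
            semiBracket (mainSymbol (V i)) (mainSymbol (V j)) z.pt + g (mainVals V z.pt)

variable {V : ι → DiffOp K}

theorem HasExpansion.add {k : ℤ} {f g : (ι → ℝ) → ℝ} {A B : Module.End ℝ (Smooth K)}
    (hA : HasExpansion V k f A) (hB : HasExpansion V k g B) :
    HasExpansion V k (fun u => f u + g u) (A + B) := by
  obtain ⟨hf, a, a', ha, B1, g1, hB1, hg1, h⟩ := hA
  obtain ⟨hg, b, b', hb, B2, g2, hB2, hg2, h'⟩ := hB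
  refine ⟨hf.add hg, a + b, a' + b', ha.add hb, fun i j u => B1 i j u + B2 i j u,
    fun u => g1 u + g2 u, fun i j => (hB1 i j).add (hB2 i j), hg1.add hg2, fun z => ⟨?_, ?_⟩⟩
  · rw [map_add, (h z).1, (h' z).1]
  · rw [map_add, (h z).2, (h' z).2]
    rw [fderiv_fun_add (hf.differentiable (by simp)).differentiableAt
      (hg.differentiable (by simp)).differentiableAt]
    simp only [_root_.add_apply, add_mul, Finset.sum_add_distrib]
    ring

/-- The semi-bracket of `f(MV)` and `g(MV)` is `∑ ∂ᵢf ∂ⱼg {MVᵢ,MVⱼ}⁺`, which is absorbed by the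
coefficients `B`; the rest is the product rule for `f g`. -/
theorem HasExpansion.mul {k l : ℤ} {f g : (ι → ℝ) → ℝ} {A B : Module.End ℝ (Smooth K)}
    (hA : HasExpansion V k f A) (hB : HasExpansion V l g B) :
    HasExpansion V (k + l) (fun u => f u * g u) (A * B) := by
  obtain ⟨hf, a, a', ha, B1, g1, hB1, hg1, h⟩ := hA
  obtain ⟨hg, b, b', hb, B2, g2, hB2, hg2, h'⟩ := hB
  have hdf : ∀ i, ContDiff ℝ ∞ fun u => fderiv ℝ f u (Pi.single i 1) := fun i =>
    (hf.fderiv_right (m := ∞) (by simp)).clm_apply contDiff_const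
  have hdg : ∀ i, ContDiff ℝ ∞ fun u => fderiv ℝ g u (Pi.single i 1) := fun i =>
    (hg.fderiv_right (m := ∞) (by simp)).clm_apply contDiff_const
  refine ⟨hf.mul hg, _, _, ha.mul isQuantization_quantizeHom hb,
    fun i j u => f u * B2 i j u + g u * B1 i j u +
      fderiv ℝ f u (Pi.single i 1) * fderiv ℝ g u (Pi.single j 1),
    fun u => f u * g2 u + g u * g1 u,
    fun i j => ((hf.mul (hB2 i j)).add (hg.mul (hB1 i j))).add ((hdf i).mul (hdg j)),
    (hf.mul hg2).add (hg.mul hg1), fun z => ⟨?_, ?_⟩⟩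
  · rw [map_mul, (h z).1, (h' z).1]
  -- The symbols agree with `f(MV)` and `g(MV)` on all of the open phase space, hence have the same
  -- derivatives there.
  · have hbr : evalSym z (symBracket (coeffDeriv K) a b) =
        semiBracket (fun w => f (mainVals V w)) (fun w => g (mainVals V w)) z.pt := by
      have h1 : polyFun a =ᶠ[𝓝 z.pt] fun w => f (mainVals V w) :=
        eventually_nhds_pt.2 (Eventually.of_forall fun y => by rw [polyFun_pt, (h y).1])
      have h2 : polyFun b =ᶠ[𝓝 z.pt] fun w => g (mainVals V w) :=
        eventually_nhds_pt.2 (Eventually.of_forall fun y => by rw [polyFun_pt, (h' y).1])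
      rw [evalSym_symBracket]
      unfold semiBracket
      rw [h1.fderiv_eq, h2.fderiv_eq]
    rw [map_add, map_add, map_mul, map_mul, hbr, semiBracket_comp_mainVals V z hf hg, (h z).1,
      (h z).2, (h' z).1, (h' z).2, fderiv_fun_mul (hf.differentiable (by simp)).differentiableAt
      (hg.differentiable (by simp)).differentiableAt]
    simp only [_root_.add_apply, _root_.smul_apply, smul_eq_mul, add_mul,
      Finset.sum_add_distrib, mul_assoc, ← Finset.mul_sum]
    ring

/-- This is the source of the term `g(MV)`: seen from one degree higher, the leading part becomes
the second one. -/
theorem HasExpansion.succ {k : ℤ} {f : (ι → ℝ) → ℝ} {A : Module.End ℝ (Smooth K)}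
    (hA : HasExpansion V k f A) : HasExpansion V (k + 1) (fun _ => 0) A := by
  obtain ⟨hf, a, a', ha, _, _, _, _, h⟩ := hA
  refine ⟨contDiff_const, 0, a, ha.succ, fun _ _ _ => 0, f, fun _ _ => contDiff_const, hf,
    fun z => ⟨map_zero _, ?_⟩⟩
  rw [(h z).1]
  simp

theorem HasExpansion.of_lt {k l : ℤ} {f : (ι → ℝ) → ℝ} {A : Module.End ℝ (Smooth K)}
    (hA : HasExpansion V k f A) (h : k < l) : HasExpansion V l (fun _ => 0) A := by
  obtain ⟨m, rfl⟩ : ∃ m : ℕ, l = k + 1 + m := ⟨(l - (k + 1)).toNat, by omega⟩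
  clear h
  induction m with
  | zero => simpa using hA.succ
  | succ m ih => simpa [add_assoc] using ih.succ

theorem hasExpansion_zero (k : ℤ) : HasExpansion V k (fun _ => 0) 0 :=
  ⟨contDiff_const, 0, 0, ⟨zero_mem _, zero_mem _, 0, zero_mem _, by simp⟩, fun _ _ _ => 0,
    fun _ => 0, fun _ _ => contDiff_const, contDiff_const, fun z => by simp⟩

theorem mainSymbol_of_ord_eq_zero {F : DiffOp K} (h : ord F = 0) (z : Phase K) :
    mainSymbol F z.pt = ((symbol F).coeff 0).1 z.1 := by
  unfold mainSymbol
  rw [h, MvPolynomial.homogeneousComponent_zero, polyFun_pt]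
  simp only [evalSym, MvPolynomial.coe_eval₂Hom, MvPolynomial.eval₂_C]
  rfl

theorem hasExpansion_lmul (Z : Coeff (IdxG V)) :
    HasExpansion V 0 (fun u => Z.1 fun j => u j.1) (Algebra.lmul ℝ (Smooth K)
      (compSmooth (fun j : IdxG V => (symbol (V j.1)).coeff 0) Z)) := by
  have hZ : ContDiff ℝ ∞ Z.1 := Z.2
  have hres : ContDiff ℝ ∞ fun (u : ι → ℝ) (j : IdxG V) => u j.1 := by fun_prop
  refine ⟨hZ.comp hres, MvPolynomial.C (compSmooth (fun j : IdxG V => (symbol (V j.1)).coeff 0) Z),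
    0, ⟨monomial_mem_degSupp (by simp) _, zero_mem _, 0, zero_mem _, ?_⟩, fun _ _ _ => 0,
    fun _ => 0, fun _ _ => contDiff_const, contDiff_const, fun z => ⟨?_, ?_⟩⟩
  · have h := isQuantization_quantizeHom.C_mul
      (compSmooth (fun j : IdxG V => (symbol (V j.1)).coeff 0) Z) 1
    rw [isQuantization_quantizeHom.one, mul_one, mul_one] at h
    rw [add_zero, add_zero, h]
  · simp only [evalSym, MvPolynomial.coe_eval₂Hom, MvPolynomial.eval₂_C]
    show Z.1 _ = Z.1 _
    refine congrArg Z.1 (funext fun j => ?_)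
    exact (mainSymbol_of_ord_eq_zero j.2 z).symm
  · rw [map_zero]
    simp only [zero_mul, Finset.sum_const_zero, add_zero]
    refine (Finset.sum_eq_zero fun i _ => ?_).symm
    -- Each term vanishes: members of order zero have `M' = 0`, and `Z` does not depend on the
    -- variables of positive order.
    by_cases hi : ord (V i) = 0
    · rw [secondMainSymbol, if_neg (by omega), Pi.zero_apply, mul_zero]
    · have h1 : HasFDerivAt (fun (u : ι → ℝ) (j : IdxG V) => u j.1)
          (ContinuousLinearMap.pi fun j : IdxG V =>
            ContinuousLinearMap.proj (R := ℝ) (φ := fun _ : ι => ℝ) j.1) (mainVals V z.pt) :=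
        (ContinuousLinearMap.pi fun j : IdxG V =>
            ContinuousLinearMap.proj (R := ℝ) (φ := fun _ : ι => ℝ) j.1).hasFDerivAt
      have h2 := (hZ.differentiable (by simp)).differentiableAt.hasFDerivAt.comp
        (mainVals V z.pt) h1
      rw [show (fun u : ι → ℝ => Z.1 fun j : IdxG V => u j.1) =
        Z.1 ∘ fun (u : ι → ℝ) (j : IdxG V) => u j.1 from rfl, h2.fderiv]
      have h3 : (ContinuousLinearMap.pi fun j : IdxG V =>
          ContinuousLinearMap.proj (R := ℝ) (φ := fun _ : ι => ℝ) j.1)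
            (Pi.single i (1 : ℝ)) = 0 := by
        ext j
        have hj : j.1 ≠ i := fun hj => hi (hj ▸ j.2)
        simp [hj]
      rw [ContinuousLinearMap.comp_apply, h3, map_zero, zero_mul]

theorem hasExpansion_self (i : ι) (hi : ord (V i) ≠ 0) :
    HasExpansion V (ord (V i)) (fun u => u i) (V i).1 := by
  have hpos : 0 < ord (V i) := Nat.pos_of_ne_zero hi
  refine ⟨contDiff_apply ℝ ℝ i, _, _, hasLeading_of_ord_pos (V i) hpos, fun _ _ _ => 0,
    fun _ => 0, fun _ _ => contDiff_const, contDiff_const, fun z => ⟨?_, ?_⟩⟩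
  · exact (polyFun_pt _ z).symm
  · have h1 : fderiv ℝ (fun u : ι → ℝ => u i) (mainVals V z.pt) =
        ContinuousLinearMap.proj (R := ℝ) (φ := fun _ : ι => ℝ) i :=
      (ContinuousLinearMap.proj (R := ℝ) (φ := fun _ : ι => ℝ) i).hasFDerivAt.fderiv
    rw [h1, ← polyFun_pt]
    simp [Pi.single_apply, secondMainSymbol, hpos]

theorem hasExpansion_algebraMap (c : ℝ) :
    HasExpansion V 0 (fun _ => c) (algebraMap ℝ (Module.End ℝ (Smooth K)) c) := by
  have h := hasExpansion_lmul (V := V) (algebraMap ℝ _ c)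
  rwa [AlgHom.commutes, AlgHom.commutes] at h

theorem HasExpansion.smul {k : ℤ} {f : (ι → ℝ) → ℝ} {A : Module.End ℝ (Smooth K)}
    (hA : HasExpansion V k f A) (c : ℝ) : HasExpansion V k (fun u => c * f u) (c • A) := by
  have h := (hasExpansion_algebraMap c).mul hA
  rwa [zero_add, ← Algebra.smul_def] at h

theorem HasExpansion.sum {α : Type*} {k : ℤ} (t : Finset α) {f : α → (ι → ℝ) → ℝ}
    {A : α → Module.End ℝ (Smooth K)} (hA : ∀ i ∈ t, HasExpansion V k (f i) (A i)) :
    HasExpansion V k (fun u => ∑ i ∈ t, f i u) (∑ i ∈ t, A i) := by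
  classical
  induction t using Finset.induction_on with
  | empty => simpa using hasExpansion_zero k
  | insert i t hi ih =>
    simp only [Finset.sum_insert hi]
    exact (hA i (Finset.mem_insert_self i t)).add
      (ih fun j hj => hA j (Finset.mem_insert_of_mem hj))

theorem HasExpansion.listProd {q : ℕ} {k : Fin q → ℤ} {f : Fin q → (ι → ℝ) → ℝ}
    {A : Fin q → Module.End ℝ (Smooth K)} (hA : ∀ i, HasExpansion V (k i) (f i) (A i)) :
    HasExpansion V (∑ i, k i) (fun u => ∏ i, f i u) (List.ofFn A).prod := by
  induction q with
  | zero => simpa using hasExpansion_algebraMap (V := V) 1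
  | succ q ih =>
    simp only [Fin.sum_univ_succ, Fin.prod_univ_succ, List.ofFn_succ, List.prod_cons]
    exact (hA 0).mul (ih fun i => hA i.succ)

theorem HasExpansion.eq_zero {k : ℤ} {f : (ι → ℝ) → ℝ} {A : Module.End ℝ (Smooth K)}
    (hA : HasExpansion V k f A) : ∃ (B : ι → ι → (ι → ℝ) → ℝ) (g : (ι → ℝ) → ℝ),
      (∀ i j, ContDiff ℝ ∞ (B i j)) ∧ ContDiff ℝ ∞ g ∧ ∀ z : Phase K,
        (∀ ψ : Smooth K, (A ψ).1 z.1 = 0) → f (mainVals V z.pt) = 0 ∧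
          ∑ i, fderiv ℝ f (mainVals V z.pt) (Pi.single i 1) * secondMainSymbol (V i) z.pt +
          ∑ i, ∑ j, B i j (mainVals V z.pt) *
            semiBracket (mainSymbol (V i)) (mainSymbol (V j)) z.pt + g (mainVals V z.pt) = 0 := by
  obtain ⟨-, a, a', ha, B, g, hB, hg, h⟩ := hA
  refine ⟨B, g, hB, hg, fun z hz => ?_⟩
  rw [← (h z).1, ← (h z).2]
  exact ha.evalSym_eq_zero hz

end Expansion

/-! ### Substitution and abelianization of monomials -/

section Substitution

variable {γ φ : Type} [Fintype γ] {A : Type} [Ring A] [Algebra ℝ A]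

open Classical in
theorem NCPoly.subst_lof_tprod_classical (g : Coeff γ →ₐ[ℝ] A) (f : φ → A) (β : Word φ)
    (Z : Fin (β.1 + 1) → Coeff γ) :
    NCPoly.subst g f (DirectSum.lof ℝ (Word φ) (fun β => ⨂[ℝ] _ : Fin (β.1 + 1), Coeff γ) β
        (PiTensorProduct.tprod ℝ Z)) =
      (List.ofFn fun k => (Fin.cons 1 fun j => f (β.2 j) : Fin (β.1 + 1) → A) k * g (Z k)).prod := by
  unfold NCPoly.subst
  rw [DirectSum.toModule_lof, PiTensorProduct.lift.tprod]
  rfl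

theorem NCPoly.subst_lof_tprod [DecidableEq (Word φ)] (g : Coeff γ →ₐ[ℝ] A) (f : φ → A)
    (β : Word φ) (Z : Fin (β.1 + 1) → Coeff γ) :
    NCPoly.subst g f (DirectSum.lof ℝ (Word φ) (fun β => ⨂[ℝ] _ : Fin (β.1 + 1), Coeff γ) β
        (PiTensorProduct.tprod ℝ Z)) =
      (List.ofFn fun k => (Fin.cons 1 fun j => f (β.2 j) : Fin (β.1 + 1) → A) k * g (Z k)).prod := by
  convert NCPoly.subst_lof_tprod_classical g f β Z

/-- The value of a commutative polynomial with smooth coefficients, as a ring homomorphism. -/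
def commEvalHom (a : γ → ℝ) (b : φ → ℝ) : MvPolynomial φ (Coeff γ) →+* ℝ :=
  MvPolynomial.eval₂Hom ((Pi.evalRingHom (fun _ : γ → ℝ => ℝ) a).comp
    (coeffSubalgebra γ).val.toRingHom) b

theorem commEvalHom_apply (a : γ → ℝ) (b : φ → ℝ) (P : MvPolynomial φ (Coeff γ)) :
    commEvalHom a b P = commEval P a b := rfl

theorem commEval_abel_lof_tprod [DecidableEq (Word φ)] (a : γ → ℝ) (b : φ → ℝ) (β : Word φ)
    (Z : Fin (β.1 + 1) → Coeff γ) :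
    commEval (NCPoly.abel (DirectSum.lof ℝ (Word φ)
        (fun β => ⨂[ℝ] _ : Fin (β.1 + 1), Coeff γ) β (PiTensorProduct.tprod ℝ Z))) a b =
      ∏ k, ((Fin.cons 1 fun j => b (β.2 j) : Fin (β.1 + 1) → ℝ) k * (Z k).1 a) := by
  rw [NCPoly.abel, NCPoly.subst_lof_tprod, ← commEvalHom_apply, map_list_prod, List.map_ofFn,
    List.prod_ofFn]
  refine Finset.prod_congr rfl fun k _ => ?_
  rw [Function.comp_apply, map_mul]
  congr 1
  · refine Fin.cases ?_ (fun j => ?_) k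
    · simp
    · simp [commEvalHom]
  · exact MvPolynomial.eval₂_C _ _ _

end Substitution

/-! ### Expansion of an evaluated noncommutative polynomial -/

section Families

variable {n : ℕ} {K : Opens (Fin n → ℝ)} {ι : Type} [Fintype ι] (V : ι → DiffOp K)

/-- The abelianization of `S` as a function of all the variables. -/
def abelFun (S : PolyFor V) (u : ι → ℝ) : ℝ :=
  commEval (NCPoly.abel S) (fun j => u j.1) (fun i => u i.1)

theorem abelFun_add (S T : PolyFor V) (u : ι → ℝ) :
    abelFun V (S + T) u = abelFun V S u + abelFun V T u := by
  simp only [abelFun, NCPoly.abel, map_add, ← commEvalHom_apply]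

theorem abelFun_smul (c : ℝ) (S : PolyFor V) (u : ι → ℝ) :
    abelFun V (c • S) u = c * abelFun V S u := by
  simp only [abelFun, NCPoly.abel, map_smul, ← commEvalHom_apply, Algebra.smul_def, map_mul]
  congr 1
  exact MvPolynomial.eval₂_C _ _ _

theorem abelFun_zero (u : ι → ℝ) : abelFun V 0 u = 0 := by
  have h := abelFun_smul V 0 0 u
  rwa [zero_smul, zero_mul] at h

theorem abelFun_sum {α : Type*} (t : Finset α) (S : α → PolyFor V) (u : ι → ℝ) :
    abelFun V (∑ i ∈ t, S i) u = ∑ i ∈ t, abelFun V (S i) u :=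
  map_sum (⟨⟨fun S => abelFun V S u, abelFun_zero V u⟩, fun S T => abelFun_add V S T u⟩ :
    PolyFor V →+ ℝ) S t

variable [DecidableEq ι]

open Classical in
theorem hasExpansion_lof (β : Word (IdxF V)) (x : ⨂[ℝ] _ : Fin (β.1 + 1), Coeff (IdxG V)) :
    HasExpansion V (Word.weight (fun i : IdxF V => ord (V i.1)) β)
      (abelFun V (DirectSum.lof ℝ (Word (IdxF V))
        (fun β => ⨂[ℝ] _ : Fin (β.1 + 1), Coeff (IdxG V)) β x))
      (evalOp V (DirectSum.lof ℝ (Word (IdxF V))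
        (fun β => ⨂[ℝ] _ : Fin (β.1 + 1), Coeff (IdxG V)) β x)) := by
  induction x using PiTensorProduct.induction_on with
  | smul_tprod r Z =>
    rw [map_smul]
    have h1 : HasExpansion V (Word.weight (fun i : IdxF V => ord (V i.1)) β)
      (abelFun V (DirectSum.lof ℝ (Word (IdxF V))
        (fun β => ⨂[ℝ] _ : Fin (β.1 + 1), Coeff (IdxG V)) β (PiTensorProduct.tprod ℝ Z)))
      (evalOp V (DirectSum.lof ℝ (Word (IdxF V))
        (fun β => ⨂[ℝ] _ : Fin (β.1 + 1), Coeff (IdxG V)) β (PiTensorProduct.tprod ℝ Z))) := by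
      rw [evalOp, NCPoly.subst_lof_tprod]
      have hf : abelFun V (DirectSum.lof ℝ (Word (IdxF V))
          (fun β => ⨂[ℝ] _ : Fin (β.1 + 1), Coeff (IdxG V)) β (PiTensorProduct.tprod ℝ Z)) =
          fun u => ∏ k, ((Fin.cons 1 fun j => u (β.2 j).1 : Fin (β.1 + 1) → ℝ) k *
            (Z k).1 fun j => u j.1) := by
        ext u
        rw [abelFun, commEval_abel_lof_tprod]
      -- The factor before `Z₀` is a dummy symbol `1`, which has weight `0`.
      have hw : ((Word.weight (fun i : IdxF V => ord (V i.1)) β : ℕ) : ℤ) =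
          ∑ k, (Fin.cons 0 fun j => (ord (V (β.2 j).1) : ℤ) : Fin (β.1 + 1) → ℤ) k := by
        rw [Fin.sum_univ_succ]
        simp [Word.weight]
      rw [hf, hw]
      refine HasExpansion.listProd (k := (Fin.cons 0 fun j => (ord (V (β.2 j).1) : ℤ)))
        fun k => ?_
      refine Fin.cases ?_ (fun j => ?_) k
      · simpa using hasExpansion_lmul (V := V) (Z 0)
      · simpa using (hasExpansion_self (β.2 j).1 (β.2 j).2).mul (hasExpansion_lmul (V := V) (Z j.succ))
    have h2 := h1.smul r
    rw [evalOp, map_smul]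
    rw [show abelFun V (r • DirectSum.lof ℝ (Word (IdxF V))
      (fun β => ⨂[ℝ] _ : Fin (β.1 + 1), Coeff (IdxG V)) β (PiTensorProduct.tprod ℝ Z)) = _ from
      funext fun u => abelFun_smul V r _ u]
    exact h2
  | add x y hx hy =>
    rw [map_add, evalOp, map_add]
    have h := hx.add hy
    simp only [← abelFun_add] at h
    exact h

open Classical in
theorem mainFun_eq_sum (S : PolyFor V) (u : ι → ℝ) :
    mainFun V S u = ∑ β ∈ DFinsupp.support S,
      if Word.weight (fun i : IdxF V => ord (V i.1)) β =
          NCPoly.deg (fun i : IdxF V => ord (V i.1)) S then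
        abelFun V (DirectSum.lof ℝ (Word (IdxF V))
          (fun β => ⨂[ℝ] _ : Fin (β.1 + 1), Coeff (IdxG V)) β (S β)) u else 0 := by
  rw [← Finset.sum_filter, ← abelFun_sum]
  show abelFun V (NCPoly.mainPart _ S) u = _
  congr 1
  have h := (DirectSum.sum_support_of
    (NCPoly.mainPart (fun i : IdxF V => ord (V i.1)) S)).symm
  have hs : DFinsupp.support (NCPoly.mainPart (fun i : IdxF V => ord (V i.1)) S) =
      (DFinsupp.support S).filter fun β => Word.weight (fun i : IdxF V => ord (V i.1)) β =
        NCPoly.deg (fun i : IdxF V => ord (V i.1)) S := by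
    unfold NCPoly.mainPart NCPoly.quasiHomPart
    convert DFinsupp.support_filter S
  rw [hs] at h
  refine h.trans (Finset.sum_congr rfl fun β hβ => ?_)
  have h2 : NCPoly.mainPart (fun i : IdxF V => ord (V i.1)) S β = S β := by
    unfold NCPoly.mainPart NCPoly.quasiHomPart
    exact DFinsupp.filter_apply_pos _ (Finset.mem_filter.1 hβ).2
  rw [h2]
  rfl

/-- Words of top weight contribute their abelianization to the leading part; words of smaller weight
contribute nothing there, and only a function of `MV` to the second part. -/
theorem hasExpansion_mainFun (S : PolyFor V) :
    HasExpansion V (NCPoly.deg (fun i : IdxF V => ord (V i.1)) S) (mainFun V S) (evalOp V S) := by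
  classical
  have h1 : evalOp V S = ∑ β ∈ DFinsupp.support S, evalOp V (DirectSum.lof ℝ (Word (IdxF V))
      (fun β => ⨂[ℝ] _ : Fin (β.1 + 1), Coeff (IdxG V)) β (S β)) := by
    simp only [evalOp, ← map_sum]
    congr 1
    exact (DirectSum.sum_support_of S).symm
  rw [show mainFun V S = _ from funext (mainFun_eq_sum V S), h1]
  refine HasExpansion.sum _ fun β hβ => ?_
  split_ifs with h
  · rw [← h]
    exact hasExpansion_lof V β (S β)
  · refine (hasExpansion_lof V β (S β)).of_lt ?_
    have h2 : Word.weight (fun i : IdxF V => ord (V i.1)) β ≤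
        NCPoly.deg (fun i : IdxF V => ord (V i.1)) S := by
      unfold NCPoly.deg
      exact Finset.le_sup (f := Word.weight (fun i : IdxF V => ord (V i.1))) (by convert hβ)
    omega

end Families

/-! ### Relations between differentials of main and second-main symbols -/

section Relations

variable {n : ℕ} {K : Opens (Fin n → ℝ)} {ι : Type}

/-- The span of the differentials of the main symbols of `V` and of their semi-brackets. -/
def relSpan (V : ι → DiffOp K) (w : (Fin n → ℝ) × (Fin n → ℝ)) :
    Submodule ℝ ((Fin n → ℝ) × (Fin n → ℝ) →L[ℝ] ℝ) :=
  Submodule.span ℝ (Set.range (fun i => fderiv ℝ (mainSymbol (V i)) w) ∪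
    Set.range (fun ij : ι × ι =>
      fderiv ℝ (semiBracket (mainSymbol (V ij.1)) (mainSymbol (V ij.2))) w))

/-- The span of the differentials of the main symbols of `V`. -/
def mainSpan (V : ι → DiffOp K) (w : (Fin n → ℝ) × (Fin n → ℝ)) :
    Submodule ℝ ((Fin n → ℝ) × (Fin n → ℝ) →L[ℝ] ℝ) :=
  Submodule.span ℝ (Set.range fun i => fderiv ℝ (mainSymbol (V i)) w)

theorem fderiv_mainSymbol_mem_relSpan (V : ι → DiffOp K) (w : (Fin n → ℝ) × (Fin n → ℝ)) (i : ι) :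
    fderiv ℝ (mainSymbol (V i)) w ∈ relSpan V w :=
  Submodule.subset_span (Or.inl ⟨i, rfl⟩)

theorem fderiv_semiBracket_mem_relSpan (V : ι → DiffOp K) (w : (Fin n → ℝ) × (Fin n → ℝ))
    (i j : ι) :
    fderiv ℝ (semiBracket (mainSymbol (V i)) (mainSymbol (V j))) w ∈ relSpan V w :=
  Submodule.subset_span (Or.inr ⟨(i, j), rfl⟩)

variable [Fintype ι] [DecidableEq ι]

theorem fderiv_comp_mainVals_mem_relSpan (V : ι → DiffOp K) (z : Phase K) {f : (ι → ℝ) → ℝ}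
    (hf : ContDiff ℝ ∞ f) : fderiv ℝ (fun w => f (mainVals V w)) z.pt ∈ relSpan V z.pt := by
  rw [fderiv_comp_family (v := mainVals V) (hf.differentiable (by simp)).differentiableAt fun i =>
    differentiableAt_mainSymbol (V i) z]
  exact Submodule.sum_mem _ fun i _ => Submodule.smul_mem _ _ (fderiv_mainSymbol_mem_relSpan V _ i)

/-- Both parts of the expansion vanish on a neighbourhood of `z`, so their differentials vanish at
`z`. Differentiating a coefficient that is a function of `MV` gives a combination of the `d(MVᵢ)`.
-/
theorem sum_smul_fderiv_mem_relSpan {V : ι → DiffOp K} {k : ℤ} {f : (ι → ℝ) → ℝ}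
    {A : Module.End ℝ (Smooth K)} (hA : HasExpansion V k f A) {z : Phase K}
    (h : ∃ H ∈ 𝓝 z.1, ∀ ψ : Smooth K, ∀ x ∈ H, (A ψ).1 x = 0) :
    ∑ i, fderiv ℝ f (mainVals V z.pt) (Pi.single i 1) • fderiv ℝ (mainSymbol (V i)) z.pt = 0 ∧
    ∑ i, fderiv ℝ f (mainVals V z.pt) (Pi.single i 1) •
      fderiv ℝ (secondMainSymbol (V i)) z.pt ∈ relSpan V z.pt := by
  obtain ⟨B, g, hB, hg, hBg⟩ := hA.eq_zero
  have hf := hA.1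
  obtain ⟨H, hH, hv⟩ := h
  have hev : ∀ᶠ y in 𝓝 z, y.1 ∈ H := continuous_fst.continuousAt.eventually hH
  constructor
  · have h1 : (fun w => f (mainVals V w)) =ᶠ[𝓝 z.pt] fun _ => 0 :=
      eventually_nhds_pt.2 (hev.mono fun y hy => (hBg y fun ψ => hv ψ _ hy).1)
    have h2 := fderiv_comp_family (v := mainVals V) (hf.differentiable (by simp)).differentiableAt fun i =>
      differentiableAt_mainSymbol (V i) z
    exact h2.symm.trans (by rw [h1.fderiv_eq]; simp)
  · have hc : ∀ i, ContDiff ℝ ∞ fun u => fderiv ℝ f u (Pi.single i 1) := fun i =>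
      (hf.fderiv_right (m := ∞) (by simp)).clm_apply contDiff_const
    have hd : ∀ {φ : (ι → ℝ) → ℝ}, ContDiff ℝ ∞ φ →
        HasFDerivAt (fun w => φ (mainVals V w)) (fderiv ℝ (fun w => φ (mainVals V w)) z.pt) z.pt :=
      fun hφ => ((hφ.contDiffAt.comp z.pt (contDiffAt_mainVals V z)).differentiableAt
        (by simp)).hasFDerivAt
    have hs : ∀ i, HasFDerivAt (secondMainSymbol (V i))
        (fderiv ℝ (secondMainSymbol (V i)) z.pt) z.pt := fun i =>
      ((contDiffAt_secondMainSymbol (V i) z).differentiableAt (by simp)).hasFDerivAt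
    have hb : ∀ i j, HasFDerivAt (semiBracket (mainSymbol (V i)) (mainSymbol (V j)))
        (fderiv ℝ (semiBracket (mainSymbol (V i)) (mainSymbol (V j))) z.pt) z.pt := fun i j =>
      ((contDiffAt_semiBracket (contDiffAt_mainSymbol (V i) z)
        (contDiffAt_mainSymbol (V j) z)).differentiableAt (by simp)).hasFDerivAt
    have h1 := ((HasFDerivAt.fun_sum (u := Finset.univ) fun i _ =>
      (hd (hc i)).mul (hs i)).add (HasFDerivAt.fun_sum (u := Finset.univ) fun i _ =>
      HasFDerivAt.fun_sum (u := Finset.univ) fun j _ => (hd (hB i j)).mul (hb i j))).add (hd hg)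
    have h2 := h1.congr_of_eventuallyEq (f₁ := fun _ => (0 : ℝ))
      (eventually_nhds_pt.2 (hev.mono fun y hy => ((hBg y fun ψ => hv ψ _ hy).2).symm))
    have h3 := h2.unique (hasFDerivAt_const (0 : ℝ) z.pt)
    rw [Finset.sum_add_distrib, add_assoc, add_assoc] at h3
    -- All terms other than `∑ ∂ᵢf d(M'Vᵢ)` go to the right-hand side; each is a multiple of the
    -- differential of a function of `MV` or of a semi-bracket.
    rw [eq_neg_of_add_eq_zero_left h3]
    refine Submodule.neg_mem _ (Submodule.add_mem _ ?_ (Submodule.add_mem _ ?_ ?_))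
    · exact Submodule.sum_mem _ fun i _ => Submodule.smul_mem _ _
        (fderiv_comp_mainVals_mem_relSpan V z (hc i))
    · exact Submodule.sum_mem _ fun i _ => Submodule.sum_mem _ fun j _ => Submodule.add_mem _
        (Submodule.smul_mem _ _ (fderiv_semiBracket_mem_relSpan V _ i j))
        (Submodule.smul_mem _ _ (fderiv_comp_mainVals_mem_relSpan V z (hB i j)))
    · exact fderiv_comp_mainVals_mem_relSpan V z hg

end Relations

/-! ### Algebraic dependence, main spans and rank -/

section Dependence

/-- Multiplication by `A⁻¹`. The matrix `T = -A⁻¹C` is fixed before `U`, `x` and `y`, so the same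
`T` serves for main and second-main symbols. -/
theorem exists_sub_sum_smul_mem {M : Type*} [AddCommGroup M] [Module ℝ M] {s r : ℕ}
    {A : Matrix (Fin s) (Fin s) ℝ} (hA : A.det ≠ 0) (C : Fin s → Fin r → ℝ) :
    ∃ T : Fin s → Fin r → ℝ, ∀ (U : Submodule ℝ M) (x : Fin s → M) (y : Fin r → M),
      (∀ i, ∑ j, A i j • x j + ∑ k, C i k • y k ∈ U) → ∀ j, x j - ∑ k, T j k • y k ∈ U := by
  refine ⟨fun j k => -∑ i, A⁻¹ j i * C i k, fun U x y h j => ?_⟩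
  have h1 := Submodule.sum_mem U fun (i : Fin s) (_ : i ∈ Finset.univ) =>
    Submodule.smul_mem U (A⁻¹ j i) (h i)
  have h2 : A⁻¹ * A = 1 := Matrix.nonsing_inv_mul A (isUnit_iff_ne_zero.2 hA)
  have h3 : ∑ i, A⁻¹ j i • ∑ k, A i k • x k = x j := by
    simp only [Finset.smul_sum, smul_smul]
    rw [Finset.sum_comm]
    simp only [← Finset.sum_smul]
    simp only [← Matrix.mul_apply, h2, Matrix.one_apply]
    simp
  have h4 : ∑ i, A⁻¹ j i • ∑ k, C i k • y k = -∑ k, (-∑ i, A⁻¹ j i * C i k) • y k := by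
    simp only [neg_smul, Finset.sum_neg_distrib, neg_neg, Finset.sum_smul, Finset.smul_sum,
      smul_smul]
    rw [Finset.sum_comm]
  simpa only [smul_add, Finset.sum_add_distrib, h3, h4, ← sub_eq_add_neg] using h1

variable {n : ℕ} {K : Opens (Fin n → ℝ)} {z : Phase K} {s r : ℕ}
  {W : Fin s → DiffOp K} {Y : Fin r → DiffOp K}

theorem AlgDependent.exists_coeff (h : AlgDependent z W Y) :
    ∃ T : Fin s → Fin r → ℝ, ∀ j,
      fderiv ℝ (mainSymbol (W j)) z.pt = ∑ k, T j k • fderiv ℝ (mainSymbol (Y k)) z.pt ∧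
      fderiv ℝ (secondMainSymbol (W j)) z.pt -
        ∑ k, T j k • fderiv ℝ (secondMainSymbol (Y k)) z.pt ∈ relSpan (Sum.elim W Y) z.pt := by
  obtain ⟨S, hdet, H, hH, hv⟩ := h
  have hrel := fun i => sum_smul_fderiv_mem_relSpan (hasExpansion_mainFun (Sum.elim W Y) (S i))
    ⟨H, hH, hv i⟩
  simp only [Fintype.sum_sum_type, Sum.elim_inl, Sum.elim_inr] at hrel
  obtain ⟨T, hT⟩ := exists_sub_sum_smul_mem (M := (Fin n → ℝ) × (Fin n → ℝ) →L[ℝ] ℝ) hdet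
    fun i k => fderiv ℝ (mainFun (Sum.elim W Y) (S i))
      (mainVals (Sum.elim W Y) z.pt) (Pi.single (Sum.inr k) 1)
  -- The subspace `⊥` yields the exact relation between main differentials, `relSpan` the relation
  -- between second-main ones.
  exact ⟨T, fun j => ⟨sub_eq_zero.1 ((Submodule.mem_bot ℝ).1
    (hT ⊥ _ _ (fun i => (Submodule.mem_bot ℝ).2 (hrel i).1) j)), hT _ _ _ (fun i => (hrel i).2) j⟩⟩

/-- The same polynomials `S` work nearby: the determinant is continuous in the point, and `H` is a
neighbourhood of the points near `z.1`. -/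
theorem AlgDependent.eventually (h : AlgDependent z W Y) : ∀ᶠ y in 𝓝 z, AlgDependent y W Y := by
  obtain ⟨S, hdet, H, hH, hv⟩ := h
  have hc : ContinuousAt (fun y : Phase K => (Matrix.of fun i h : Fin s =>
      fderiv ℝ (mainFun (Sum.elim W Y) (S i))
      (fun k => mainSymbol (Sum.elim W Y k) y.pt) (Pi.single (Sum.inl h) 1)).det) z := by
    refine (continuous_id.matrix_det).continuousAt.comp (continuousAt_pi.2 fun i =>
      continuousAt_pi.2 fun j => ?_)
    have h1 : Continuous fun u => fderiv ℝ (mainFun (Sum.elim W Y) (S i)) u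
        (Pi.single (Sum.inl j) 1) :=
      ((hasExpansion_mainFun (Sum.elim W Y) (S i)).1.continuous_fderiv (by simp)).clm_apply
        continuous_const
    have h2 : ContinuousAt (fun y : Phase K => mainVals (Sum.elim W Y) y.pt) z :=
      (contDiffAt_mainVals (Sum.elim W Y) z).continuousAt.comp
        isOpenEmbedding_pt.continuous.continuousAt
    exact h1.continuousAt.comp h2
  have hH' : ∀ᶠ y in 𝓝 z, H ∈ 𝓝 y.1 :=
    continuous_fst.continuousAt.eventually (eventually_mem_nhds_iff.2 hH)
  filter_upwards [hc.eventually_ne hdet, hH'] with y hy1 hy2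
  exact ⟨S, hy1, H, hy2, hv⟩

theorem eventually_transGen {a b : Σ q : ℕ, (Fin q → DiffOp K)}
    (h : Relation.TransGen (fun A B : Σ q : ℕ, (Fin q → DiffOp K) => AlgDependent z A.2 B.2)
      a b) : ∀ᶠ y in 𝓝 z, Relation.TransGen
        (fun A B : Σ q : ℕ, (Fin q → DiffOp K) => AlgDependent y A.2 B.2) a b := by
  induction h with
  | single h => exact h.eventually.mono fun y hy => Relation.TransGen.single hy
  | tail _ h ih => filter_upwards [ih, h.eventually] with y h1 h2 using h1.tail h2

theorem AlgContained.eventually (h : AlgContained z W Y) : ∀ᶠ y in 𝓝 z, AlgContained y W Y :=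
  eventually_transGen h

theorem AlgDependent.mainSpan_le (h : AlgDependent z W Y) : mainSpan W z.pt ≤ mainSpan Y z.pt := by
  obtain ⟨T, hT⟩ := h.exists_coeff
  refine Submodule.span_le.2 ?_
  rintro _ ⟨j, rfl⟩
  simp only [(hT j).1]
  exact Submodule.sum_mem _ fun k _ => Submodule.smul_mem _ _ (Submodule.subset_span ⟨k, rfl⟩)

theorem mainSpan_le_of_reflTransGen {a b : Σ q : ℕ, (Fin q → DiffOp K)}
    (h : Relation.ReflTransGen (fun A B : Σ q : ℕ, (Fin q → DiffOp K) => AlgDependent z A.2 B.2)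
      a b) : mainSpan a.2 z.pt ≤ mainSpan b.2 z.pt := by
  induction h with
  | refl => exact le_rfl
  | tail _ h ih => exact ih.trans h.mainSpan_le

theorem eventually_reflTransGen {a b : Σ q : ℕ, (Fin q → DiffOp K)}
    (h : Relation.ReflTransGen (fun A B : Σ q : ℕ, (Fin q → DiffOp K) => AlgDependent z A.2 B.2)
      a b) : ∀ᶠ y in 𝓝 z, Relation.ReflTransGen
        (fun A B : Σ q : ℕ, (Fin q → DiffOp K) => AlgDependent y A.2 B.2) a b := by
  induction h with
  | refl => exact Eventually.of_forall fun y => Relation.ReflTransGen.refl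
  | tail _ h ih => filter_upwards [ih, h.eventually] with y h1 h2 using h1.tail h2

theorem mainDim_le (Y : Fin r → DiffOp K) (z : Phase K) : mainDim Y z ≤ r :=
  (finrank_range_le_card _).trans_eq (Fintype.card_fin r)

theorem mainDim_eq (W : Fin s → DiffOp K) (z : Phase K) :
    mainDim W z = Module.finrank ℝ (mainSpan W z.pt) := rfl

theorem mainDim_le_mainDim_of_le {z' : Phase K} (h : mainSpan W z.pt ≤ mainSpan Y z'.pt) :
    mainDim W z ≤ mainDim Y z' := by
  rw [mainDim_eq, mainDim_eq]
  exact Submodule.finrank_mono h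

theorem AlgContained.mainDim_le_mainDim (h : AlgContained z W Y) : mainDim W z ≤ mainDim Y z :=
  mainDim_le_mainDim_of_le
    (mainSpan_le_of_reflTransGen (a := ⟨s, W⟩) (b := ⟨r, Y⟩) (Relation.TransGen.to_reflTransGen h))

theorem eventually_linearIndependent {κ : Type*} [Finite κ] {F : κ → DiffOp K}
    (h : LinearIndependent ℝ fun k => fderiv ℝ (mainSymbol (F k)) z.pt) :
    ∀ᶠ y in 𝓝 z, LinearIndependent ℝ fun k => fderiv ℝ (mainSymbol (F k)) (Phase.pt y) := by
  have hc : ContinuousAt (fun (y : Phase K) k => fderiv ℝ (mainSymbol (F k)) y.pt) z :=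
    continuousAt_pi.2 fun k => ContinuousAt.comp
      (f := (Phase.pt : Phase K → _)) (g := fderiv ℝ (mainSymbol (F k)))
      ((contDiffAt_mainSymbol (F k) z).fderiv_right (m := 0) (by simp)).continuousAt
      isOpenEmbedding_pt.continuous.continuousAt
  exact hc.eventually h.eventually

/-- A subfamily whose main symbols have linearly independent differentials at the point. -/
theorem exists_mainFrame (W : Fin s → DiffOp K) (z : Phase K) :
    ∃ a : Fin (mainDim W z) → Fin s,
      LinearIndependent ℝ fun k => fderiv ℝ (mainSymbol (W (a k))) z.pt := by
  obtain ⟨κ, a, ha, hspan, hli⟩ :=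
    exists_linearIndependent' ℝ fun i => fderiv ℝ (mainSymbol (W i)) z.pt
  have : Finite κ := Finite.of_injective a ha
  have := Fintype.ofFinite κ
  have hcard : Fintype.card κ = mainDim W z := by
    rw [mainDim, ← hspan]
    exact (finrank_span_eq_card hli).symm
  have e : Fin (mainDim W z) ≃ κ := (finCongr hcard.symm).trans (Fintype.equivFin κ).symm
  exact ⟨a ∘ e, hli.comp e e.injective⟩

theorem card_le_mainDim {m : ℕ} {a : Fin m → Fin s}
    (h : LinearIndependent ℝ fun k => fderiv ℝ (mainSymbol (W (a k))) z.pt) :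
    m ≤ mainDim W z := by
  rw [mainDim_eq, ← Fintype.card_fin m, ← finrank_span_eq_card h]
  exact Submodule.finrank_mono (Submodule.span_mono (Set.range_subset_iff.2 fun k => ⟨a k, rfl⟩))

/-- Linear independence of finitely many continuous covectors is an open condition. -/
theorem eventually_mainDim_le (W : Fin s → DiffOp K) (z : Phase K) :
    ∀ᶠ y in 𝓝 z, mainDim W z ≤ mainDim W y := by
  obtain ⟨a, ha⟩ := exists_mainFrame W z
  exact (eventually_linearIndependent ha).mono fun y hy => card_le_mainDim hy

/-- The main dimension does not decrease along chains and is at most the number of operators, so it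
bounds the size of every possible target from below. -/
theorem rank_eq_of_algContained (h : AlgContained z W Y) (hd : mainDim W z = r) : rank W z = r := by
  have hne : {r | ∃ Y : Fin r → DiffOp K, AlgContained z W Y}.Nonempty := ⟨r, Y, h⟩
  refine le_antisymm (Nat.sInf_le ⟨Y, h⟩) ?_
  obtain ⟨Y', h'⟩ := Nat.sInf_mem hne
  rw [← hd]
  exact h'.mainDim_le_mainDim.trans (mainDim_le Y' z)

end Dependence

/-! ### Semi-brackets of functionally dependent functions -/

section FunctionalDependence

variable {κ : Type*} [Fintype κ]

/-- A nonzero functional vanishing on the range of `(φ a)` would be a linear relation among the `φ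
a`, so the joint map is onto and splits. -/
theorem exists_rightInverse_pi {E : Type*} [NormedAddCommGroup E] [NormedSpace ℝ E]
    {φ : κ → E →L[ℝ] ℝ} (h : LinearIndependent ℝ φ) :
    ∃ σ : (κ → ℝ) →L[ℝ] E, (ContinuousLinearMap.pi φ).comp σ = ContinuousLinearMap.id ℝ _ := by
  classical
  have hsurj : LinearMap.range (ContinuousLinearMap.pi φ : E →ₗ[ℝ] κ → ℝ) = ⊤ := by
    by_contra hne
    obtain ⟨θ, hθ, hle⟩ := Submodule.exists_le_ker_of_lt_top _ (lt_top_iff_ne_top.2 hne)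
    refine hθ ?_
    have h1 : ∑ a, θ (Pi.single a 1) • φ a = 0 := by
      ext u
      have h2 : θ (ContinuousLinearMap.pi φ u) = 0 := hle ⟨u, rfl⟩
      have h3 : ContinuousLinearMap.pi φ u = ∑ a, φ a u • (Pi.single a 1 : κ → ℝ) := by
        ext j
        simp [Finset.sum_apply, Pi.single_apply]
      rw [h3, map_sum] at h2
      simpa [mul_comm] using h2
    have h2 := Fintype.linearIndependent_iff.1 h _ h1
    refine LinearMap.pi_ext' fun a => LinearMap.ext_ring ?_
    simpa using h2 a
  obtain ⟨σ, hσ⟩ := LinearMap.exists_rightInverse_of_surjective _ hsurj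
  refine ⟨LinearMap.toContinuousLinearMap σ, ?_⟩
  ext1 u
  exact LinearMap.congr_fun hσ u

/-- If `df` lies in the span of the differentials `dwₐ` near `z` and these are independent at `z`,
then the coefficients of `df` depend differentiably on the point. -/
theorem exists_differentiableAt_coeff {E : Type*} [NormedAddCommGroup E] [NormedSpace ℝ E]
    {w : κ → E → E →L[ℝ] ℝ} {f : E → E →L[ℝ] ℝ} {z : E}
    (hw : ∀ a, DifferentiableAt ℝ (w a) z) (hf : DifferentiableAt ℝ f z)
    (hli : LinearIndependent ℝ fun a => w a z)
    (hspan : ∀ᶠ y in 𝓝 z, f y ∈ Submodule.span ℝ (Set.range fun a => w a y)) :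
    ∃ c : κ → E → ℝ, (∀ a, DifferentiableAt ℝ (c a) z) ∧
      ∀ᶠ y in 𝓝 z, f y = ∑ a, c a y • w a y := by
  classical
  obtain ⟨σ, hσ⟩ := exists_rightInverse_pi hli
  -- With `σ` a right inverse at `z`, `N` is the identity there and invertible nearby; the
  -- coefficients are recovered as `f ∘ σ ∘ N⁻¹`, differentiable at `z`.
  set N : E → (κ → ℝ) →L[ℝ] (κ → ℝ) := fun y =>
    (ContinuousLinearMap.pi fun a => w a y).comp σ with hN
  have hL : DifferentiableAt ℝ (fun y => ContinuousLinearMap.pi fun a => w a y) z := by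
    have h1 : (fun y => ContinuousLinearMap.pi fun a => w a y) = fun y =>
        ∑ a, (ContinuousLinearMap.single ℝ (fun _ : κ => ℝ) a).comp (w a y) := by
      ext y u j
      simp [Pi.single_apply]
    rw [h1]
    exact DifferentiableAt.fun_sum fun a _ => (differentiableAt_const _).clm_comp (hw a)
  have hNd : DifferentiableAt ℝ N z := hL.clm_comp (differentiableAt_const σ)
  have hNz : N z = 1 := hσ
  have hunit : IsUnit (N z) := hNz ▸ isUnit_one
  have hinv : DifferentiableAt ℝ (fun y => Ring.inverse (N y)) z :=
    (differentiableAt_inverse (𝕜 := ℝ) hunit).comp z hNd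
  have hev : ∀ᶠ y in 𝓝 z, IsUnit (N y) :=
    hNd.continuousAt.eventually (Units.isOpen.mem_nhds hunit)
  refine ⟨fun a y => ((f y).comp σ) (Ring.inverse (N y) (Pi.single a 1)), fun a => ?_, ?_⟩
  · exact (hf.clm_comp (differentiableAt_const σ)).clm_apply
      (hinv.clm_apply (differentiableAt_const _))
  · filter_upwards [hspan, hev] with y hy hyu
    obtain ⟨c, hc⟩ := (Submodule.mem_span_range_iff_exists_fun ℝ).1 hy
    have key : ∀ ξ, ((f y).comp σ) ξ = ∑ a, c a * N y ξ a := fun ξ => by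
      rw [← hc]
      simp [hN]
    have h1 : ∀ a, ((f y).comp σ) (Ring.inverse (N y) (Pi.single a 1)) = c a := fun a => by
      rw [key]
      have h2 : N y (Ring.inverse (N y) (Pi.single a 1)) = Pi.single a 1 := by
        have h3 := Ring.mul_inverse_cancel _ hyu
        exact congrArg (fun T : (κ → ℝ) →L[ℝ] (κ → ℝ) => T (Pi.single a 1)) h3
      rw [h2]
      simp [Pi.single_apply]
    simp only [h1]
    exact hc.symm

/-- Differentiating `df = ∑ cₐ dwₐ` in a direction `v` and evaluating on `u` leaves the extra terms
`dcₐ(v) dwₐ(u)`, which vanish when `u` is in the common kernel. Symmetry of second derivatives then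
exchanges `u` and `v`. -/
theorem exists_fderiv_fderiv_eq {E : Type*} [NormedAddCommGroup E] [NormedSpace ℝ E]
    {w : κ → E → ℝ} {f : E → ℝ} {z : E} (hw : ∀ a, ContDiffAt ℝ ∞ (w a) z)
    (hf : ContDiffAt ℝ ∞ f z) (hli : LinearIndependent ℝ fun a => fderiv ℝ (w a) z)
    (hspan : ∀ᶠ y in 𝓝 z, fderiv ℝ f y ∈ Submodule.span ℝ (Set.range fun a => fderiv ℝ (w a) y)) :
    ∃ c : κ → ℝ, fderiv ℝ f z = ∑ a, c a • fderiv ℝ (w a) z ∧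
      ∀ u, (∀ a, fderiv ℝ (w a) z u = 0) →
        fderiv ℝ (fderiv ℝ f) z u = ∑ a, c a • fderiv ℝ (fderiv ℝ (w a)) z u := by
  have hd : ∀ {g : E → ℝ}, ContDiffAt ℝ ∞ g z → DifferentiableAt ℝ (fderiv ℝ g) z := fun hg =>
    (hg.fderiv_right (m := ∞) (by simp)).differentiableAt (by simp)
  have hs : ∀ {g : E → ℝ}, ContDiffAt ℝ ∞ g z → IsSymmSndFDerivAt ℝ g z := fun hg =>
    hg.isSymmSndFDerivAt (by simpa using (WithTop.coe_le_coe.2 (le_top : (2 : ℕ∞) ≤ ⊤)))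
  obtain ⟨c, hc, heq⟩ := exists_differentiableAt_coeff (fun a => hd (hw a)) (hd hf) hli hspan
  refine ⟨fun a => c a z, heq.self_of_nhds, fun u hu => ?_⟩
  have h1 := HasFDerivAt.fun_sum (u := Finset.univ) fun a _ =>
    (hc a).hasFDerivAt.smul (hd (hw a)).hasFDerivAt
  have h2 := (h1.congr_of_eventuallyEq heq).fderiv
  ext v
  rw [hs hf u v, h2]
  simp only [_root_.sum_apply, _root_.add_apply, _root_.smul_apply,
    ContinuousLinearMap.smulRight_apply, hu, smul_zero, add_zero]
  exact Finset.sum_congr rfl fun a _ => by rw [hs (hw a) v u]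

theorem mem_span_of_forall_apply_eq_zero {E ι : Type*} [Finite ι] [NormedAddCommGroup E]
    [NormedSpace ℝ E] {φ : ι → E →L[ℝ] ℝ} {θ : E →L[ℝ] ℝ}
    (h : ∀ u, (∀ i, φ i u = 0) → θ u = 0) : θ ∈ Submodule.span ℝ (Set.range φ) := by
  cases nonempty_fintype ι
  have h1 : (θ : E →ₗ[ℝ] ℝ) ∈ Submodule.span ℝ (Set.range fun i => (φ i : E →ₗ[ℝ] ℝ)) := by
    refine mem_span_of_iInf_ker_le_ker fun u hu => ?_
    rw [Submodule.mem_iInf] at hu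
    exact h u hu
  obtain ⟨c, hc⟩ := (Submodule.mem_span_range_iff_exists_fun ℝ).1 h1
  refine (Submodule.mem_span_range_iff_exists_fun ℝ).2 ⟨c, ?_⟩
  ext u
  have h2 := LinearMap.congr_fun hc u
  simpa using h2

variable {n : ℕ}

theorem fderiv_semiBracket_apply {A B : (Fin n → ℝ) × (Fin n → ℝ) → ℝ}
    {z : (Fin n → ℝ) × (Fin n → ℝ)} (hA : ContDiffAt ℝ ∞ A z) (hB : ContDiffAt ℝ ∞ B z)
    (u : (Fin n → ℝ) × (Fin n → ℝ)) :
    fderiv ℝ (semiBracket A B) z u =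
      ∑ i, (fderiv ℝ A z (0, Pi.single i 1) * fderiv ℝ (fderiv ℝ B) z u (Pi.single i 1, 0) +
        fderiv ℝ B z (Pi.single i 1, 0) * fderiv ℝ (fderiv ℝ A) z u (0, Pi.single i 1)) := by
  have hd : ∀ {g : (Fin n → ℝ) × (Fin n → ℝ) → ℝ}, ContDiffAt ℝ ∞ g z → ∀ v,
      HasFDerivAt (fun y => fderiv ℝ g y v) ((fderiv ℝ (fderiv ℝ g) z).flip v) z := fun hg v => by
    have h := ((hg.fderiv_right (m := ∞) (by simp)).differentiableAt
      (by simp)).hasFDerivAt.clm_apply (hasFDerivAt_const v z)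
    simpa using h
  have h1 : HasFDerivAt (semiBracket A B) _ z := HasFDerivAt.fun_sum (u := Finset.univ) fun i _ =>
    (hd hA (0, Pi.single i 1)).mul (hd hB (Pi.single i 1, 0))
  rw [h1.fderiv]
  simp

/-- By duality it suffices to test on vectors `u` killed by all the spanning covectors. On the
common kernel of the `dwₐ`, both first and second derivatives of `f` and `g` behave as if the
coefficients `c`, `e` were constant, so `d{f,g}⁺(u) = ∑ cₐ e_b d{wₐ,w_b}⁺(u)`. No explicit
functional dependence `f = F(w)` is needed. -/
theorem fderiv_semiBracket_mem_span {w : κ → (Fin n → ℝ) × (Fin n → ℝ) → ℝ}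
    {f g : (Fin n → ℝ) × (Fin n → ℝ) → ℝ} {z : (Fin n → ℝ) × (Fin n → ℝ)}
    (hw : ∀ a, ContDiffAt ℝ ∞ (w a) z) (hf : ContDiffAt ℝ ∞ f z) (hg : ContDiffAt ℝ ∞ g z)
    (hli : LinearIndependent ℝ fun a => fderiv ℝ (w a) z)
    (hfs : ∀ᶠ y in 𝓝 z, fderiv ℝ f y ∈ Submodule.span ℝ (Set.range fun a => fderiv ℝ (w a) y))
    (hgs : ∀ᶠ y in 𝓝 z, fderiv ℝ g y ∈ Submodule.span ℝ (Set.range fun a => fderiv ℝ (w a) y)) :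
    fderiv ℝ (semiBracket f g) z ∈ Submodule.span ℝ
      (Set.range (fun a => fderiv ℝ (w a) z) ∪
        Set.range fun ab : κ × κ => fderiv ℝ (semiBracket (w ab.1) (w ab.2)) z) := by
  obtain ⟨c, hc, hc'⟩ := exists_fderiv_fderiv_eq hw hf hli hfs
  obtain ⟨e, he, he'⟩ := exists_fderiv_fderiv_eq hw hg hli hgs
  rw [← Set.Sum.elim_range]
  refine mem_span_of_forall_apply_eq_zero fun u hu => ?_
  have hu1 : ∀ a, fderiv ℝ (w a) z u = 0 := fun a => hu (Sum.inl a)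
  have hu2 : ∀ a b, fderiv ℝ (semiBracket (w a) (w b)) z u = 0 := fun a b => hu (Sum.inr (a, b))
  have key : fderiv ℝ (semiBracket f g) z u =
      ∑ a, ∑ b, c a * e b * fderiv ℝ (semiBracket (w a) (w b)) z u := by
    simp only [fderiv_semiBracket_apply (hw _) (hw _)]
    rw [fderiv_semiBracket_apply hf hg, hc' u hu1, he' u hu1, hc, he]
    simp only [_root_.sum_apply, _root_.smul_apply, smul_eq_mul, Finset.mul_sum (ι := Fin n)]
    simp only [Finset.sum_comm (s := (Finset.univ : Finset κ)) (t := (Finset.univ : Finset (Fin n)))]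
    refine Finset.sum_congr rfl fun i _ => ?_
    rw [Finset.sum_mul_sum, mul_comm (∑ b, e b * _), Finset.sum_mul_sum, ← Finset.sum_add_distrib]
    refine Finset.sum_congr rfl fun a _ => ?_
    rw [← Finset.sum_add_distrib]
    exact Finset.sum_congr rfl fun b _ => by ring
  rw [key]
  exact Finset.sum_eq_zero fun a _ => Finset.sum_eq_zero fun b _ => by rw [hu2, mul_zero]

end FunctionalDependence

/-! ### Transport of relations along the chain -/

section MainRelation

variable {n : ℕ} {K : Opens (Fin n → ℝ)} {z : Phase K} {s r : ℕ}
  {W : Fin s → DiffOp K} {Y : Fin r → DiffOp K}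

/-- A squeeze at each nearby point: the `r` independent frame covectors span a subspace of the main
span of `Y`, whose dimension is at most `r`. The two are equal and contain the main span of every
set from which `Y` is reached. -/
theorem eventually_mem_span_frame (h : AlgContained z W Y) {a : Fin r → Fin s}
    (ha : LinearIndependent ℝ fun k => fderiv ℝ (mainSymbol (W (a k))) z.pt)
    {c : Σ q : ℕ, (Fin q → DiffOp K)}
    (hc : Relation.ReflTransGen (fun A B : Σ q : ℕ, (Fin q → DiffOp K) => AlgDependent z A.2 B.2)
      c ⟨r, Y⟩) (i : Fin c.1) :
    ∀ᶠ w in 𝓝 z.pt, fderiv ℝ (mainSymbol (c.2 i)) w ∈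
      Submodule.span ℝ (Set.range fun k => fderiv ℝ (mainSymbol (W (a k))) w) := by
  rw [eventually_nhds_pt]
  filter_upwards [h.eventually, eventually_linearIndependent ha, eventually_reflTransGen hc]
    with y hy hli hcy
  have h1 : Submodule.span ℝ (Set.range fun k => fderiv ℝ (mainSymbol (W (a k))) y.pt) ≤
      mainSpan W y.pt := Submodule.span_mono (Set.range_subset_iff.2 fun k => ⟨a k, rfl⟩)
  have h2 : mainSpan W y.pt ≤ mainSpan Y y.pt :=
    mainSpan_le_of_reflTransGen (a := ⟨s, W⟩) (b := ⟨r, Y⟩) (Relation.TransGen.to_reflTransGen hy)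
  have h3 : mainSpan c.2 y.pt ≤ mainSpan Y y.pt := mainSpan_le_of_reflTransGen (b := ⟨r, Y⟩) hcy
  have h4 : Module.finrank ℝ (mainSpan Y y.pt) ≤
      Module.finrank ℝ
        (Submodule.span ℝ (Set.range fun k => fderiv ℝ (mainSymbol (W (a k))) y.pt)) := by
    rw [finrank_span_eq_card hli, Fintype.card_fin, ← mainDim_eq]
    exact mainDim_le Y y
  rw [Submodule.eq_of_le_of_finrank_le (h1.trans h2) h4]
  exact h3 (Submodule.subset_span ⟨i, rfl⟩)

theorem relSpan_le {a : Fin r → Fin s}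
    (ha : LinearIndependent ℝ fun k => fderiv ℝ (mainSymbol (W (a k))) z.pt)
    {ι : Type} {V : ι → DiffOp K}
    (hV : ∀ i, ∀ᶠ w in 𝓝 z.pt, fderiv ℝ (mainSymbol (V i)) w ∈
      Submodule.span ℝ (Set.range fun k => fderiv ℝ (mainSymbol (W (a k))) w)) :
    relSpan V z.pt ≤ relSpan W z.pt := by
  refine Submodule.span_le.2 ?_
  rintro _ (⟨i, rfl⟩ | ⟨⟨i, j⟩, rfl⟩)
  · refine Submodule.span_mono ?_ (hV i).self_of_nhds
    rintro _ ⟨k, rfl⟩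
    exact Or.inl ⟨a k, rfl⟩
  · refine Submodule.span_mono ?_ (fderiv_semiBracket_mem_span
      (fun k => contDiffAt_mainSymbol (W (a k)) z) (contDiffAt_mainSymbol (V i) z)
      (contDiffAt_mainSymbol (V j) z) ha (hV i) (hV j))
    rintro _ (⟨k, rfl⟩ | ⟨⟨k, l⟩, rfl⟩)
    · exact Or.inl ⟨a k, rfl⟩
    · exact Or.inr ⟨(a k, a l), rfl⟩

/-- Induction from the end of the chain: a relation `γ` at one set becomes the relation `γT` at the
next, and the error lies in the joint `relSpan`, which is contained in that of `W`. -/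
theorem sum_smul_fderiv_secondMainSymbol_mem (h : AlgContained z W Y) (hd : mainDim W z = r)
    (γ : Fin s → ℝ) (hγ : ∑ i, γ i • fderiv ℝ (mainSymbol (W i)) z.pt = 0) :
    ∑ i, γ i • fderiv ℝ (secondMainSymbol (W i)) z.pt ∈ relSpan W z.pt := by
  obtain ⟨a, ha⟩ : ∃ a : Fin r → Fin s,
      LinearIndependent ℝ fun k => fderiv ℝ (mainSymbol (W (a k))) z.pt :=
    hd ▸ exists_mainFrame W z
  have key : ∀ b : Σ q : ℕ, (Fin q → DiffOp K), Relation.ReflTransGen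
      (fun A B : Σ q : ℕ, (Fin q → DiffOp K) => AlgDependent z A.2 B.2) b ⟨r, Y⟩ →
      ∀ γ : Fin b.1 → ℝ, ∑ i, γ i • fderiv ℝ (mainSymbol (b.2 i)) z.pt = 0 →
        ∑ i, γ i • fderiv ℝ (secondMainSymbol (b.2 i)) z.pt ∈ relSpan W z.pt := by
    intro b hb
    induction hb using Relation.ReflTransGen.head_induction_on with
    | refl =>
      intro γ hγ
      -- The main span of `Y` has dimension at least `mainDim W z = r`, the number of members of
      -- `Y`, so only the zero relation remains.
      have hli : LinearIndependent ℝ fun k => fderiv ℝ (mainSymbol (Y k)) z.pt := by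
        rw [linearIndependent_iff_card_le_finrank_span, Fintype.card_fin]
        exact hd.symm.le.trans h.mainDim_le_mainDim
      have h0 := Fintype.linearIndependent_iff.1 hli γ hγ
      simp only [h0, zero_smul, Finset.sum_const_zero]
      exact Submodule.zero_mem _
    | @head b c hbc hc ih =>
      intro γ hγ
      obtain ⟨T, hT⟩ := AlgDependent.exists_coeff hbc
      have hle : relSpan (Sum.elim b.2 c.2) z.pt ≤ relSpan W z.pt := by
        refine relSpan_le ha ?_
        rintro (i | i)
        · exact eventually_mem_span_frame h ha (hc.head hbc) i
        · exact eventually_mem_span_frame h ha hc i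
      have hswap : ∀ m : Fin c.1 → ((Fin n → ℝ) × (Fin n → ℝ) →L[ℝ] ℝ),
          ∑ k, (∑ j, γ j * T j k) • m k = ∑ j, γ j • ∑ k, T j k • m k := by
        intro m
        simp only [Finset.sum_smul, Finset.smul_sum, smul_smul]
        rw [Finset.sum_comm]
      have h1 := ih (fun k => ∑ j, γ j * T j k) (by
        rw [hswap, ← hγ]
        exact Finset.sum_congr rfl fun j _ => by rw [(hT j).1])
      rw [hswap] at h1
      have h2 := Submodule.sum_mem (relSpan W z.pt) fun (j : Fin b.1) (_ : j ∈ Finset.univ) =>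
        Submodule.smul_mem _ (γ j) (hle (hT j).2)
      have h3 := Submodule.add_mem _ h2 h1
      rw [← Finset.sum_add_distrib] at h3
      simpa only [smul_sub, sub_add_cancel] using h3
  exact key ⟨s, W⟩ (Relation.TransGen.to_reflTransGen h) γ hγ

end MainRelation

end DiffOps

end

/-! ### Conclusion on a neighbourhood of the point -/

theorem mainTheorem5 {n s : ℕ} (K : TopologicalSpace.Opens (Fin n → ℝ))
    (W : Fin s → DiffOps.DiffOp K) (z : DiffOps.Phase K)
    (hdim : DiffOps.mainDim W z + 1 = s) (hdep : DiffOps.RegularlyDependent W z) :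
    ∃ O ∈ 𝓝 z, ∀ y ∈ O,
      DiffOps.rank W y + 1 = s ∧ DiffOps.mainDim W y + 1 = s ∧
      ∀ γ : Fin s → ℝ, γ ≠ 0 →
        ∑ i, γ i • fderiv ℝ (DiffOps.mainSymbol (W i)) y.pt = 0 →
        ∑ i, γ i • fderiv ℝ (DiffOps.secondMainSymbol (W i)) y.pt ∈
          Submodule.span ℝ
            (Set.range (fun i : Fin s => fderiv ℝ (DiffOps.mainSymbol (W i)) y.pt) ∪
              Set.range (fun ij : Fin s × Fin s =>
                fderiv ℝ (DiffOps.semiBracket (DiffOps.mainSymbol (W ij.1))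
                  (DiffOps.mainSymbol (W ij.2))) y.pt)) := by
  obtain ⟨r, hr, Y, hY⟩ := hdep
  have hzr := hY.mainDim_le_mainDim.trans (DiffOps.mainDim_le Y z)
  have hev : ∀ᶠ y in 𝓝 z, DiffOps.AlgContained y W Y ∧ DiffOps.mainDim W y = r := by
    filter_upwards [hY.eventually, DiffOps.eventually_mainDim_le W z] with y h1 h2
    have h3 := h1.mainDim_le_mainDim.trans (DiffOps.mainDim_le Y y)
    -- Squeeze: `s - 1 ≤ mainDim W y ≤ r < s`.
    exact ⟨h1, by omega⟩
  refine ⟨_, hev, fun y hy => ?_⟩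
  obtain ⟨h1, h2⟩ := hy
  refine ⟨?_, by omega, fun γ _ hγ => DiffOps.sum_smul_fderiv_secondMainSymbol_mem h1 h2 γ hγ⟩
  rw [DiffOps.rank_eq_of_algContained h1 h2]
  omega
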